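/- Let $d\ge 1$, $L\ge 0$ and let $m_0=d$, $m_1,\dots,m_L$, $m_{L+1}=1$ be positive integers. Let $\sigma(a)=\max\{a,0\}$, applied coordinatewise, and consider the fully connected ReLU network $$\tilde f_\theta(x)=\mathcal L_L\circ\sigma\circ\mathcal L_{L-1}\circ\cdots\circ\sigma\circ\mathcal L_0(x),\qquad x\in\mathbb R^d,$$ where $\mathcal L_i(y)=\sqrt2\,(W_iy+b_i)/\sqrt{m_{i+1}}$ for $0\le i\le L-1$, $\mathcal L_L(y)=W_Ly+b_L$, $W_i\in\mathbb R^{m_{i+1}\times m_i}$, $b_i\in\mathbb R^{m_{i+1}}$, and $\theta$ collects all $W_i$ and $b_i$, $0\le i\le L$. At the random initialization $\theta_0$, all entries of $W_0,\dots,W_L$ and of $b_0$ are i.i.d. standard normal, and $b_i=0$ for $i\ge1$. Put $f_\theta=\tilde f_\theta-\tilde f_{\theta_0}$ and $$K^{\mathrm{NT}}_{\theta_0}(x,x')=\nabla_\theta f_\theta(x)^T\,\nabla_\theta f_\theta(x')\big|_{\theta=\theta_0}.$$ Fix $d$, $L$ and a constant $C$, and for every integer $m\ge1$ let the hidden widths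 satisfy $m\le m_i\le Cm$ for $1\le i\le L$. Then, as $m\to\infty$, for all $x,x'\in\mathbb R^d$ the gradients at $\theta_0$ exist with probability tending to $1$, and $K^{\mathrm{NT}}_{\theta_0}(x,x')$ converges in probability to $$K^{\mathrm{NT}}(x,x')=\sum_{l=0}^{L}\Big(\sqrt{(\|x\|_2^2+1)(\|x'\|_2^2+1)}\;\kappa_1^{(l)}(\tilde u)+\mathbf 1_{l\ge1}\Big)\prod_{r=l}^{L-1}\kappa_0\big(\kappa_1^{(r)}(\tilde u)\big),$$ where $$\tilde u=\frac{x^Tx'+1}{\sqrt{(\|x\|_2^2+1)(\|x'\|_2^2+1)}},\quad \kappa_0(t)=\frac1\pi(\pi-\arccos t),\quad \kappa_1(t)=\frac1\pi\Big[\sqrt{1-t^2}+t(\pi-\arccos t)\Big],$$ $\kappa_1^{(r)}$ is the $r$-fold composition of $\kappa_1$ with itself, $\kappa_1^{(0)}$ is the identity, and an empty product is $1$. -/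

import Mathlib

open MeasureTheory ProbabilityTheory Filter Topology

namespace NTK

noncomputable section

/-- The layer sizes `m_0 = d`, `m_i = w i` for `1 ≤ i ≤ L`, and `m_{L+1} = 1`
(all values beyond `L` are `1`; only the indices `0, …, L + 1` are used). -/
def layerDim (d L : ℕ) (w : ℕ → ℕ) : ℕ → ℕ
  | 0 => d
  | i + 1 => if i < L then w (i + 1) else 1

/-- Indices of the scalar parameters. `inl ⟨i, j, k⟩` is the weight `(W_i)_{jk}`, with
`W_i` of size `m_{i+1} × m_i`, and `inr ⟨i, j⟩` is the bias `(b_i)_j`, with `b_i` of size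
`m_{i+1}`; here `i = 0, …, L`. -/
abbrev ParamIdx (d L : ℕ) (w : ℕ → ℕ) : Type :=
  (Σ i : Fin (L + 1), Fin (layerDim d L w (i + 1)) × Fin (layerDim d L w i)) ⊕
    (Σ i : Fin (L + 1), Fin (layerDim d L w (i + 1)))

/-- The space of all parameters `θ = (W_0, b_0, …, W_L, b_L)`, with its Euclidean structure. -/
abbrev Params (d L : ℕ) (w : ℕ → ℕ) : Type := EuclideanSpace ℝ (ParamIdx d L w)

variable {d L : ℕ} {w : ℕ → ℕ}

/-- The weight matrix `W_i`. -/
def weight (θ : Params d L w) (i : Fin (L + 1)) :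
    Matrix (Fin (layerDim d L w (i + 1))) (Fin (layerDim d L w i)) ℝ :=
  Matrix.of fun j k => θ (Sum.inl ⟨i, j, k⟩)

/-- The bias vector `b_i`. -/
def bias (θ : Params d L w) (i : Fin (L + 1)) : Fin (layerDim d L w (i + 1)) → ℝ :=
  fun j => θ (Sum.inr ⟨i, j⟩)

/-- The affine map `y ↦ W_i y + b_i`. -/
def affine (θ : Params d L w) (i : Fin (L + 1)) (y : Fin (layerDim d L w i) → ℝ) :
    Fin (layerDim d L w (i + 1)) → ℝ :=
  (weight θ i).mulVec y + bias θ i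

/-- The rectified linear unit. -/
def relu (a : ℝ) : ℝ := max a 0

/-- The values fed into the `i`-th affine map: `x` for `i = 0`, and
`σ (√2 (W_i y + b_i) / √m_{i+1})` at level `i + 1`, where `y` are the values at level `i`. -/
def hidden (θ : Params d L w) (x : EuclideanSpace ℝ (Fin d)) :
    (i : ℕ) → i ≤ L → Fin (layerDim d L w i) → ℝ
  | 0, _ => fun j => x j
  | i + 1, h => fun j =>
      relu (√2 * affine θ ⟨i, by omega⟩ (hidden θ x i (by omega)) j
        / √(layerDim d L w (i + 1) : ℝ))

/-- The network `f̃_θ`: the unscaled affine map number `L` applied to the last hidden layer. Its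
output has exactly one coordinate. -/
def net (θ : Params d L w) (x : EuclideanSpace ℝ (Fin d)) : ℝ :=
  affine θ (Fin.last L) (hidden θ x L le_rfl) ⟨0, by simp [layerDim]⟩

/-- The centred network `f_θ = f̃_θ - f̃_{θ₀}`, where `θ₀` is the initialization. -/
def centredNet (θ₀ θ : Params d L w) (x : EuclideanSpace ℝ (Fin d)) : ℝ :=
  net θ x - net θ₀ x

/-- The finite-width neural tangent kernel `⟨∇_θ f_θ(x), ∇_θ f_θ(x')⟩` at `θ`, where the gradient
is taken with respect to all weights and all biases, for a network initialized at `θ₀`. -/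
def finiteNTK (θ₀ θ : Params d L w) (x x' : EuclideanSpace ℝ (Fin d)) : ℝ :=
  inner ℝ (gradient (fun ϑ => centredNet θ₀ ϑ x) θ) (gradient (fun ϑ => centredNet θ₀ ϑ x') θ)

/-- The law of a single parameter at initialization: all weights and the entries of `b_0` are
standard normal, the other biases are `0`. -/
def initCoord : ParamIdx d L w → Measure ℝ
  | Sum.inl _ => gaussianReal 0 1
  | Sum.inr ⟨i, _⟩ => if i = 0 then gaussianReal 0 1 else Measure.dirac 0

/-- The law of the initialization `θ₀`: the scalar parameters are independent. -/
def initLaw (d L : ℕ) (w : ℕ → ℕ) : Measure (Params d L w) :=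
  (Measure.pi (initCoord (d := d) (L := L) (w := w))).map (WithLp.toLp 2)

/-- The arc-cosine kernel of degree `0`. -/
def kappa0 (t : ℝ) : ℝ := 1 / Real.pi * (Real.pi - Real.arccos t)

/-- The arc-cosine kernel of degree `1`. -/
def kappa1 (t : ℝ) : ℝ := 1 / Real.pi * (√(1 - t ^ 2) + t * (Real.pi - Real.arccos t))

/-- `√((‖x‖² + 1) (‖x'‖² + 1))`. -/
def scale (x x' : EuclideanSpace ℝ (Fin d)) : ℝ := √((‖x‖ ^ 2 + 1) * (‖x'‖ ^ 2 + 1))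

/-- `ũ = (xᵀ x' + 1) / √((‖x‖² + 1) (‖x'‖² + 1))`. -/
def uTilde (x x' : EuclideanSpace ℝ (Fin d)) : ℝ := (inner ℝ x x' + 1) / scale x x'

end

end NTK

/-! Given the layers below `i`, the pre-activations of layer `i` are independent across neurons. For
each neuron, the values at `x` and `x'` form a centred Gaussian pair whose covariances are entries
of `gram`. Averages over a wide layer concentrate, and the Gaussian expectations of relu·relu and
step·step, computed in polar coordinates, are `kappa1 / 2` (times the scale) and `kappa0 / 2`. By
induction the Gram entries converge to `gramLimit` (`tendsto_gram`). Since `kappa1 1 = 1`, the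
diagonal ones keep the limit ‖x‖² + 1 at every depth.

The tangent kernel Θ_i of layer `i` is a matrix indexed by pairs of neurons, and `layerNTK_succ`
reads Θ_{i+1}(j,k) = δ_jk (G_{i+1} + 1) + Σ_{ab} T_ab W_ja W_kb, where T_ab is (2/width) · step ·
step · Θ_i(a,b). Given the layers up to `i`, the bilinear form has mean δ_jk tr T and variance at
most 2‖T‖² in Frobenius norm. Entrywise convergence of Θ_i would not control these quantities,
because they sum over a growing number of neurons. The induction therefore carries two averaged
statements: `DiagConverges`, which sends tr T to its limit, and `MeanSqVanishes`, which makes ‖T‖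
vanish. The limits satisfy Θ_{i+1} = Θ_i κ₀(κ₁^{(i)}(ũ)) + G_{i+1} + 1, and the sum in the theorem
solves this recursion. The output layer has width one, so there the averaged statement concerns the
kernel itself.

Conditioning is expressed by resampling one layer from an independent copy
(`tendsto_zero_of_lintegral_resample`). Gradients exist where no hidden pre-activation vanishes, an
event of probability tending to one (`eventually_preact_ne_zero`). -/

open scoped NNReal

namespace NTK

/-! ### Convergence in probability along a filter, and a conditional Markov inequality. -/

section ConvergenceInProbability

variable {Ω : ℕ → Type*} [∀ m, MeasurableSpace (Ω m)]

/-- The filter of the events whose probability tends to `1`. Convergence in probability is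
convergence along this filter. -/
def probFilter (μ : ∀ m, Measure (Ω m)) : Filter (Σ m, Ω m) where
  sets := {S | Tendsto (fun m => μ m {ω | (⟨m, ω⟩ : Σ m, Ω m) ∉ S}) atTop (𝓝 0)}
  univ_sets := by simp
  sets_of_superset := by
    intro S T hS hST
    refine tendsto_of_tendsto_of_tendsto_of_le_of_le tendsto_const_nhds hS (fun _ => zero_le)
      (fun m => measure_mono fun ω hω h => hω (hST h))
  inter_sets := by
    intro S T hS hT
    have h : Tendsto (fun m => μ m {ω | (⟨m, ω⟩ : Σ m, Ω m) ∉ S}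
        + μ m {ω | (⟨m, ω⟩ : Σ m, Ω m) ∉ T}) atTop (𝓝 0) := by
      simpa using Tendsto.add hS hT
    refine tendsto_of_tendsto_of_tendsto_of_le_of_le tendsto_const_nhds h (fun _ => zero_le)
      (fun m => ?_)
    refine le_trans (measure_mono fun ω hω => ?_) (measure_union_le _ _)
    by_contra hc
    simp only [Set.mem_union, Set.mem_ofPred_eq, not_or, not_not] at hc
    exact hω hc

lemma eventually_probFilter {μ : ∀ m, Measure (Ω m)} {P : (Σ m, Ω m) → Prop} :
    (∀ᶠ p in probFilter μ, P p) ↔ Tendsto (fun m => μ m {ω | ¬ P ⟨m, ω⟩}) atTop (𝓝 0) :=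
  Iff.rfl

lemma tendsto_fst_probFilter (μ : ∀ m, Measure (Ω m)) :
    Tendsto (fun p : Σ m, Ω m => p.1) (probFilter μ) atTop := by
  refine tendsto_atTop.2 fun n => eventually_probFilter.2 ?_
  refine tendsto_const_nhds.congr' ?_
  filter_upwards [eventually_ge_atTop n] with m hm
  simp [hm]

lemma tendsto_measure_le_abs_sub {μ : ∀ m, Measure (Ω m)} {X : (Σ m, Ω m) → ℝ} {c : ℝ}
    (h : Tendsto X (probFilter μ) (𝓝 c)) {ε : ℝ} (hε : 0 < ε) :
    Tendsto (fun m => μ m {ω | ε ≤ |X ⟨m, ω⟩ - c|}) atTop (𝓝 0) := by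
  have h1 := eventually_probFilter.1 (Metric.tendsto_nhds.1 h ε hε)
  simpa only [Real.dist_eq, not_lt] using h1

lemma tendsto_zero_iff_eventually_lt {α : Type*} {F : Filter α} {X : α → ℝ} (hX : ∀ p, 0 ≤ X p) :
    Tendsto X F (𝓝 0) ↔ ∀ ε > 0, ∀ᶠ p in F, X p < ε := by
  simp [Metric.tendsto_nhds, abs_of_nonneg (hX _)]

/-- A nonnegative variable tends to `0` in probability if its conditional expectation does. The
conditioning is expressed by a measure-preserving map `R` that resamples part of the data. -/
lemma tendsto_zero_of_lintegral_resample {μ : ∀ m, Measure (Ω m)} [∀ m, IsProbabilityMeasure (μ m)]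
    {R : ∀ m, Ω m × Ω m → Ω m} (hR : ∀ m, MeasurePreserving (R m) ((μ m).prod (μ m)) (μ m))
    {X g : (Σ m, Ω m) → ℝ} (hX : ∀ p, 0 ≤ X p) (hXm : ∀ m, Measurable fun ω => X ⟨m, ω⟩)
    (hg : Tendsto g (probFilter μ) (𝓝 0))
    (hXg : ∀ᶠ p in probFilter μ,
      ∫⁻ ω', ENNReal.ofReal (X ⟨p.1, R p.1 (p.2, ω')⟩) ∂(μ p.1) ≤ ENNReal.ofReal (g p)) :
    Tendsto X (probFilter μ) (𝓝 0) := by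
  rw [tendsto_zero_iff_eventually_lt hX]
  intro ε hε
  rw [eventually_probFilter]
  simp only [not_lt]
  rw [ENNReal.tendsto_nhds_zero]
  intro η hη
  -- The tolerance η may be infinite, while the Markov threshold below has to be a real number.
  obtain ⟨η', hη'0, hη'⟩ : ∃ η' : ℝ, 0 < η' ∧ ENNReal.ofReal η' ≤ η / 2 := by
    by_cases h : η = ⊤
    · exact ⟨1, one_pos, by simp [h, ENNReal.top_div]⟩
    · refine ⟨(η / 2).toReal, ENNReal.toReal_pos (by simpa using hη.ne') ?_,
        ENNReal.ofReal_toReal_le⟩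
      exact ENNReal.div_ne_top h (by simp)
  -- With conditional expectation below η'ε, Markov's inequality at level ε gives conditional
  -- probability at most η'.
  have hbad : ∀ᶠ p in probFilter μ,
      ∫⁻ ω', ENNReal.ofReal (X ⟨p.1, R p.1 (p.2, ω')⟩) ∂(μ p.1) < ENNReal.ofReal (η' * ε) := by
    filter_upwards [hXg, hg.eventually_lt_const (show 0 < η' * ε by positivity)] with p h1 h2
    exact h1.trans_lt ((ENNReal.ofReal_lt_ofReal_iff (by positivity)).2 h2)
  have hbad' := eventually_probFilter.1 hbad
  rw [ENNReal.tendsto_nhds_zero] at hbad'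
  filter_upwards [hbad' (η / 2) (by simpa using hη.ne')] with m hm
  have hXR : Measurable fun q : Ω m × Ω m => X ⟨m, R m q⟩ := (hXm m).comp (hR m).measurable
  set H : Ω m → ENNReal := fun ω => ∫⁻ ω', ENNReal.ofReal (X ⟨m, R m (ω, ω')⟩) ∂(μ m) with hH
  have hHm : Measurable H := hXR.ennreal_ofReal.lintegral_prod_right'
  have hS : MeasurableSet {q : Ω m × Ω m | ε ≤ X ⟨m, R m q⟩} :=
    measurableSet_le measurable_const hXR
  have hbm : MeasurableSet {ω | ¬ H ω < ENNReal.ofReal (η' * ε)} :=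
    (measurableSet_lt hHm measurable_const).compl
  calc μ m {ω | ε ≤ X ⟨m, ω⟩}
      = ((μ m).prod (μ m)) {q | ε ≤ X ⟨m, R m q⟩} :=
        ((hR m).measure_preimage (measurableSet_le measurable_const (hXm m)).nullMeasurableSet).symm
    _ = ∫⁻ ω, μ m {ω' | ε ≤ X ⟨m, R m (ω, ω')⟩} ∂(μ m) := Measure.prod_apply hS
    _ ≤ ∫⁻ ω, ({ω | ¬ H ω < ENNReal.ofReal (η' * ε)}.indicator 1 ω + ENNReal.ofReal η')
          ∂(μ m) := by
        refine lintegral_mono fun ω => ?_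
        -- Markov's inequality is used where the conditional expectation is small; on the remaining
        -- rare event the conditional probability is bounded by 1.
        by_cases hω : H ω < ENNReal.ofReal (η' * ε)
        · refine le_add_left ?_
          have h1 : ENNReal.ofReal ε * μ m {ω' | ENNReal.ofReal ε ≤
              ENNReal.ofReal (X ⟨m, R m (ω, ω')⟩)} ≤ H ω :=
            mul_meas_ge_le_lintegral (hXR.comp measurable_prodMk_left).ennreal_ofReal _
          have h2 : μ m {ω' | ε ≤ X ⟨m, R m (ω, ω')⟩} ≤ μ m {ω' | ENNReal.ofReal ε ≤
              ENNReal.ofReal (X ⟨m, R m (ω, ω')⟩)} :=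
            measure_mono fun ω' h => ENNReal.ofReal_le_ofReal h
          have h3 : ENNReal.ofReal ε * μ m {ω' | ε ≤ X ⟨m, R m (ω, ω')⟩}
              ≤ ENNReal.ofReal ε * ENNReal.ofReal η' := by
            rw [← ENNReal.ofReal_mul hε.le, mul_comm ε]
            exact (mul_le_mul_right h2 _).trans (h1.trans hω.le)
          exact (ENNReal.mul_le_mul_iff_right (by simpa using hε) ENNReal.ofReal_ne_top).1 h3
        · refine le_add_right ?_
          have : ω ∈ {ω | ¬ H ω < ENNReal.ofReal (η' * ε)} := hω
          rw [Set.indicator_of_mem this]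
          exact prob_le_one
    _ = μ m {ω | ¬ H ω < ENNReal.ofReal (η' * ε)} + ENNReal.ofReal η' := by
        rw [lintegral_add_right _ measurable_const, lintegral_indicator_one hbm]
        simp
    _ ≤ η / 2 + η / 2 := add_le_add hm hη'
    _ = η := ENNReal.add_halves η

end ConvergenceInProbability

/-! ### Replacing a block of independent coordinates by an independent copy. -/

section Resample

variable {ι : Type*}

/-- Replace the coordinates in `S` of the first vector by those of the second one. -/
noncomputable def resample (S : ι → Prop) (q : EuclideanSpace ℝ ι × EuclideanSpace ℝ ι) :
    EuclideanSpace ℝ ι :=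
  open Classical in WithLp.toLp 2 fun i => if S i then q.2 i else q.1 i

lemma resample_of_mem {S : ι → Prop} {i : ι} (h : S i)
    (q : EuclideanSpace ℝ ι × EuclideanSpace ℝ ι) : resample S q i = q.2 i := by
  simp [resample, h]

lemma resample_of_notMem {S : ι → Prop} {i : ι} (h : ¬ S i)
    (q : EuclideanSpace ℝ ι × EuclideanSpace ℝ ι) : resample S q i = q.1 i := by
  simp [resample, h]

/-- The preimage of a box is a product of two boxes, and each coordinate is constrained in exactly
one of them. The product measure of the preimage is therefore that of the original box. -/
lemma measurePreserving_resample [Fintype ι] (μ : ι → Measure ℝ) [∀ i, IsProbabilityMeasure (μ i)]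
    (S : ι → Prop) :
    MeasurePreserving (resample S)
      (((Measure.pi μ).map (WithLp.toLp 2)).prod ((Measure.pi μ).map (WithLp.toLp 2)))
      ((Measure.pi μ).map (WithLp.toLp 2)) := by
  classical
  have hto : Measurable (WithLp.toLp 2 : (ι → ℝ) → EuclideanSpace ℝ ι) := by fun_prop
  have hmeas : Measurable fun q : (ι → ℝ) × (ι → ℝ) => fun i => if S i then q.2 i else q.1 i := by
    refine measurable_pi_lambda _ fun i => ?_
    split_ifs <;> fun_prop
  have h1 : ((Measure.pi μ).prod (Measure.pi μ)).map
      (fun q : (ι → ℝ) × (ι → ℝ) => fun i => if S i then q.2 i else q.1 i) = Measure.pi μ := by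
    refine (Measure.pi_eq fun s hs => ?_).symm
    rw [Measure.map_apply hmeas (MeasurableSet.univ_pi hs)]
    have : (fun q : (ι → ℝ) × (ι → ℝ) => fun i => if S i then q.2 i else q.1 i) ⁻¹'
        Set.univ.pi s = (Set.univ.pi fun i => if S i then Set.univ else s i) ×ˢ
          (Set.univ.pi fun i => if S i then s i else Set.univ) := by
      ext q
      simp only [Set.mem_preimage, Set.mem_pi, Set.mem_univ, true_imp_iff, Set.mem_prod,
        ← forall_and]
      refine forall_congr' fun i => ?_
      split_ifs <;> simp
    rw [this, Measure.prod_prod, Measure.pi_pi, Measure.pi_pi, ← Finset.prod_mul_distrib]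
    refine Finset.prod_congr rfl fun i _ => ?_
    split_ifs <;> simp
  have hR : Measurable (resample S) := by
    refine (hto.comp (measurable_pi_lambda _ fun i => ?_))
    split_ifs <;> fun_prop
  refine ⟨hR, ?_⟩
  rw [Measure.map_prod_map _ _ hto hto, Measure.map_map hR (by fun_prop)]
  conv_rhs => rw [← h1]
  rw [Measure.map_map hto hmeas]
  rfl

end Resample

/-! ### The arc-cosine kernels as expectations over two standard normals. -/

section ArcCosine

/-- The derivative of the rectified linear unit away from `0`. -/
noncomputable def step (a : ℝ) : ℝ := if 0 < a then 1 else 0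

lemma step_mul_of_pos {c : ℝ} (hc : 0 < c) (a : ℝ) : step (c * a) = step a := by
  simp [step, hc]

lemma step_nonneg (a : ℝ) : 0 ≤ step a := by unfold step; split_ifs <;> simp

lemma step_le_one (a : ℝ) : step a ≤ 1 := by unfold step; split_ifs <;> simp

lemma step_mul_self (a : ℝ) : step a * step a = step a := by unfold step; split_ifs <;> simp

lemma measurable_step : Measurable step :=
  Measurable.ite measurableSet_Ioi measurable_const measurable_const

lemma relu_eq_step_mul (a : ℝ) : relu a = step a * a := by
  unfold relu step
  split_ifs with h
  · simp [h.le]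
  · simp [not_lt.1 h]

lemma relu_mul_of_nonneg {c : ℝ} (hc : 0 ≤ c) (a : ℝ) : relu (c * a) = c * relu a := by
  unfold relu
  rw [mul_max_of_nonneg _ _ hc, mul_zero]

lemma relu_sq_le (a : ℝ) : relu a ^ 2 ≤ a ^ 2 := by
  rw [relu_eq_step_mul, mul_pow]
  have h1 : step a ^ 2 ≤ 1 := by rw [sq, step_mul_self]; exact step_le_one a
  nlinarith [sq_nonneg a]

lemma measurable_relu : Measurable relu := measurable_id.max measurable_const

/-- Two open half-circles whose axes differ by α meet in an arc of length π - α; this is the source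
of π - arccos in both kernels. -/
lemma cos_pos_and_cos_sub_pos_iff {α θ : ℝ} (hα : α ∈ Set.Icc 0 Real.pi)
    (hθ : θ ∈ Set.Ioo (-Real.pi) Real.pi) :
    (0 < Real.cos θ ∧ 0 < Real.cos (θ - α)) ↔
      θ ∈ Set.Ioo (α - Real.pi / 2) (Real.pi / 2) := by
  obtain ⟨h1, h2⟩ := hα
  obtain ⟨h3, h4⟩ := hθ
  have hpi := Real.pi_pos
  constructor
  · rintro ⟨h5, h6⟩
    have h7 : θ < Real.pi / 2 := by
      by_contra h
      exact absurd h5 (not_lt.2 (Real.cos_nonpos_of_pi_div_two_le_of_le (not_lt.1 h)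
        (by linarith)))
    refine ⟨?_, h7⟩
    by_contra h
    -- Below -π/2, the cosine of θ - α can become positive again only past -3π/2; there θ < α - 3π/2
    -- ≤ -π/2, so the cosine of θ itself is not positive.
    have h8 : Real.cos (-(θ - α)) ≤ 0 ∨ θ - α < -(3 * Real.pi / 2) := by
      by_cases h9 : θ - α < -(3 * Real.pi / 2)
      · exact Or.inr h9
      · exact Or.inl (Real.cos_nonpos_of_pi_div_two_le_of_le (by linarith) (by linarith))
    rcases h8 with h8 | h8
    · rw [Real.cos_neg] at h8
      linarith
    · have : Real.cos (-θ) ≤ 0 :=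
        Real.cos_nonpos_of_pi_div_two_le_of_le (by linarith) (by linarith)
      rw [Real.cos_neg] at this
      linarith
  · rintro ⟨h5, h6⟩
    exact ⟨Real.cos_pos_of_mem_Ioo ⟨by linarith, h6⟩,
      Real.cos_pos_of_mem_Ioo ⟨by linarith, by linarith⟩⟩

lemma setIntegral_step_cos_mul {α : ℝ} (hα : α ∈ Set.Icc 0 Real.pi) (g : ℝ → ℝ) :
    ∫ θ in Set.Ioo (-Real.pi) Real.pi, step (Real.cos θ) * step (Real.cos (θ - α)) * g θ =
      ∫ θ in (α - Real.pi / 2)..(Real.pi / 2), g θ := by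
  have hpi := Real.pi_pos
  have h1 : ∀ θ ∈ Set.Ioo (-Real.pi) Real.pi,
      step (Real.cos θ) * step (Real.cos (θ - α)) * g θ =
        (Set.Ioo (α - Real.pi / 2) (Real.pi / 2)).indicator g θ := by
    intro θ hθ
    have := cos_pos_and_cos_sub_pos_iff hα hθ
    by_cases h : θ ∈ Set.Ioo (α - Real.pi / 2) (Real.pi / 2)
    · rw [Set.indicator_of_mem h]
      obtain ⟨h2, h3⟩ := this.2 h
      simp [step, h2, h3]
    · rw [Set.indicator_of_notMem h]
      have h2 := mt this.1 h
      unfold step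
      by_cases h3 : 0 < Real.cos θ
      · simp [not_and.1 h2 h3]
      · simp [h3]
  rw [setIntegral_congr_fun measurableSet_Ioo h1, setIntegral_indicator measurableSet_Ioo,
    Set.inter_eq_right.2 (Set.Ioo_subset_Ioo (by linarith [hα.1]) (by linarith)),
    intervalIntegral.integral_of_le (by linarith [hα.2]), integral_Ioc_eq_integral_Ioo]

lemma integral_cos_mul_cos_sub (α : ℝ) :
    ∫ θ in (α - Real.pi / 2)..(Real.pi / 2), Real.cos θ * Real.cos (θ - α) =
      ((Real.pi - α) * Real.cos α + Real.sin α) / 2 := by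
  -- The antiderivative comes from cos θ cos (θ - α) = (cos α + cos (2θ - α)) / 2.
  have h : ∀ θ ∈ Set.uIcc (α - Real.pi / 2) (Real.pi / 2),
      HasDerivAt (fun θ => (θ * Real.cos α + Real.sin (2 * θ - α) / 2) / 2)
        (Real.cos θ * Real.cos (θ - α)) θ := by
    intro θ _
    have h1 : HasDerivAt (fun θ : ℝ => 2 * θ - α) 2 θ := by
      simpa using ((hasDerivAt_id θ).const_mul 2).sub_const α
    have h2 := (((hasDerivAt_id θ).mul_const (Real.cos α)).add (h1.sin.div_const 2)).div_const 2
    convert! h2 using 1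
    have e : 2 * θ - α = θ + (θ - α) := by ring
    have e2 : Real.cos α = Real.cos (θ - (θ - α)) := by ring_nf
    rw [e, e2, Real.cos_add, Real.cos_sub θ (θ - α)]
    ring
  rw [intervalIntegral.integral_eq_sub_of_hasDerivAt h
    (Continuous.intervalIntegrable (by fun_prop) _ _)]
  have e1 : 2 * (Real.pi / 2) - α = Real.pi - α := by ring
  have e2 : 2 * (α - Real.pi / 2) - α = α - Real.pi := by ring
  rw [e1, e2, Real.sin_pi_sub, Real.sin_sub_pi]
  ring

lemma integral_pow_mul_exp_neg_sq_div_two (k : ℕ) :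
    ∫ r in Set.Ioi (0 : ℝ), r ^ k * Real.exp (-(r ^ 2) / 2) =
      (1 / 2 : ℝ) ^ (-((k : ℝ) + 1) / 2) * (1 / 2) * Real.Gamma (((k : ℝ) + 1) / 2) := by
  rw [← integral_rpow_mul_exp_neg_mul_rpow two_pos (q := k) (by linarith [k.cast_nonneg (α := ℝ)])
    (by norm_num : (0 : ℝ) < 1 / 2)]
  refine setIntegral_congr_fun measurableSet_Ioi fun r _ => ?_
  simp only [Real.rpow_natCast, Real.rpow_two]
  ring_nf

lemma integral_mul_exp_neg_sq_div_two :
    ∫ r in Set.Ioi (0 : ℝ), r ^ 1 * Real.exp (-(r ^ 2) / 2) = 1 := by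
  rw [integral_pow_mul_exp_neg_sq_div_two]
  norm_num [Real.rpow_neg_one]

lemma integral_pow_three_mul_exp_neg_sq_div_two :
    ∫ r in Set.Ioi (0 : ℝ), r ^ 3 * Real.exp (-(r ^ 2) / 2) = 2 := by
  rw [integral_pow_mul_exp_neg_sq_div_two]
  have : (1 / 2 : ℝ) ^ (-((3 : ℕ) + 1 : ℝ) / 2) = 4 := by
    rw [show (-((3 : ℕ) + 1 : ℝ) / 2) = -(2 : ℕ) by norm_num, Real.rpow_neg (by norm_num),
      Real.rpow_natCast]
    norm_num
  rw [this]
  norm_num [Real.Gamma_two]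

/-- Expectation of a positively homogeneous function of two independent standard normals. -/
lemma integral_gaussian_prod_of_homogeneous {f : ℝ × ℝ → ℝ} (k : ℕ)
    (hf : ∀ r : ℝ, 0 < r → ∀ y z, f (r * y, r * z) = r ^ k * f (y, z)) :
    ∫ p, f p ∂((gaussianReal 0 1).prod (gaussianReal 0 1)) =
      (1 / (2 * Real.pi)) * ((∫ r in Set.Ioi (0 : ℝ), r ^ (k + 1) * Real.exp (-(r ^ 2) / 2)) *
        ∫ θ in Set.Ioo (-Real.pi) Real.pi, f (Real.cos θ, Real.sin θ)) := by
  have hpi := Real.pi_pos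
  -- In polar coordinates the integral factorises by homogeneity. The Jacobian contributes one
  -- factor of the radius, whence the exponent k + 1.
  rw [gaussianReal_of_var_ne_zero _ one_ne_zero,
    prod_withDensity (measurable_gaussianPDF 0 1) (measurable_gaussianPDF 0 1),
    integral_withDensity_eq_integral_toReal_smul (by fun_prop)
      (ae_of_all _ fun _ => ENNReal.mul_lt_top gaussianPDF_lt_top gaussianPDF_lt_top),
    ← Measure.volume_eq_prod, ← integral_comp_polarCoord_symm, ← setIntegral_prod_mul,
    ← integral_const_mul, polarCoord_target, ← Measure.volume_eq_prod]
  refine setIntegral_congr_fun (measurableSet_Ioi.prod measurableSet_Ioo) fun p hp => ?_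
  have hp1 : 0 < p.1 := hp.1
  simp only [polarCoord_symm_apply, smul_eq_mul, ENNReal.toReal_mul, toReal_gaussianPDF,
    gaussianPDFReal_def, hf p.1 hp1, NNReal.coe_one, sub_zero, mul_one]
  have h1 : (√(2 * Real.pi))⁻¹ * (√(2 * Real.pi))⁻¹ = 1 / (2 * Real.pi) := by
    rw [← mul_inv, Real.mul_self_sqrt (by positivity), one_div]
  have h2 : Real.exp (-(p.1 * Real.cos p.2) ^ 2 / 2) * Real.exp (-(p.1 * Real.sin p.2) ^ 2 / 2)
      = Real.exp (-p.1 ^ 2 / 2) := by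
    rw [← Real.exp_add]
    congr 1
    linear_combination (-p.1 ^ 2 / 2) * Real.sin_sq_add_cos_sq p.2
  rw [← h1, ← h2]
  ring

/-- On the unit circle, correlation ρ amounts to a rotation by arccos ρ. -/
lemma cos_sub_arccos {ρ : ℝ} (hρ : ρ ∈ Set.Icc (-1) 1) (θ : ℝ) :
    ρ * Real.cos θ + √(1 - ρ ^ 2) * Real.sin θ = Real.cos (θ - Real.arccos ρ) := by
  rw [Real.cos_sub, Real.cos_arccos hρ.1 hρ.2, Real.sin_arccos]
  ring

/-- The integrand is homogeneous of degree 0, so the value is the length π - arccos ρ of the common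
arc divided by 2π. -/
lemma integral_step_mul_step {ρ : ℝ} (hρ : ρ ∈ Set.Icc (-1) 1) :
    ∫ p : ℝ × ℝ, step p.1 * step (ρ * p.1 + √(1 - ρ ^ 2) * p.2)
      ∂((gaussianReal 0 1).prod (gaussianReal 0 1)) = kappa0 ρ / 2 := by
  rw [integral_gaussian_prod_of_homogeneous 0, zero_add, integral_mul_exp_neg_sq_div_two]
  · simp only [cos_sub_arccos hρ]
    have h := setIntegral_step_cos_mul ⟨Real.arccos_nonneg ρ, Real.arccos_le_pi ρ⟩ (fun _ => 1)
    simp only [mul_one] at h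
    rw [h]
    simp only [intervalIntegral.integral_const, kappa0]
    simp
    ring
  · intro r hr y z
    have : ρ * (r * y) + √(1 - ρ ^ 2) * (r * z) = r * (ρ * y + √(1 - ρ ^ 2) * z) := by ring
    simp only [this, step_mul_of_pos hr, pow_zero, one_mul]

/-- The degree of homogeneity is 2, so the radial factor is ∫ r³ exp(-r²/2) = 2. On the common arc
the integrand is a product of two cosines. -/
lemma integral_relu_mul_relu {ρ : ℝ} (hρ : ρ ∈ Set.Icc (-1) 1) :
    ∫ p : ℝ × ℝ, relu p.1 * relu (ρ * p.1 + √(1 - ρ ^ 2) * p.2)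
      ∂((gaussianReal 0 1).prod (gaussianReal 0 1)) = kappa1 ρ / 2 := by
  rw [integral_gaussian_prod_of_homogeneous 2, integral_pow_three_mul_exp_neg_sq_div_two]
  · simp only [cos_sub_arccos hρ]
    have h := setIntegral_step_cos_mul ⟨Real.arccos_nonneg ρ, Real.arccos_le_pi ρ⟩
      (fun θ => Real.cos θ * Real.cos (θ - Real.arccos ρ))
    rw [integral_cos_mul_cos_sub, Real.cos_arccos hρ.1 hρ.2, Real.sin_arccos] at h
    have e : ∀ θ, relu (Real.cos θ) * relu (Real.cos (θ - Real.arccos ρ)) =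
        step (Real.cos θ) * step (Real.cos (θ - Real.arccos ρ)) *
          (Real.cos θ * Real.cos (θ - Real.arccos ρ)) := by
      intro θ
      rw [relu_eq_step_mul, relu_eq_step_mul]
      ring
    simp only [e, h, kappa1]
    have := Real.pi_pos
    field_simp
    ring
  · intro r hr y z
    have : ρ * (r * y) + √(1 - ρ ^ 2) * (r * z) = r * (ρ * y + √(1 - ρ ^ 2) * z) := by ring
    simp only [this, relu_mul_of_nonneg hr.le]
    ring

end ArcCosine

/-! ### Second and fourth moments of a normal variable. -/

section GaussianMoments

lemma integrable_pow_gaussianReal (v : ℝ≥0) (k : ℕ) :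
    Integrable (fun x : ℝ => x ^ k) (gaussianReal 0 v) := by
  have h := (memLp_id_gaussianReal (μ := 0) (v := v) k).integrable_norm_pow'
  refine h.mono' (by fun_prop) (ae_of_all _ fun x => ?_)
  simp

lemma integral_pow_two_gaussianReal (v : ℝ≥0) : ∫ x, x ^ 2 ∂(gaussianReal 0 v) = v := by
  have h := variance_fun_id_gaussianReal (μ := 0) (v := v)
  rw [variance_eq_integral (by fun_prop)] at h
  simpa using h

lemma integral_pow_four_gaussianReal_one : ∫ x, x ^ 4 ∂(gaussianReal 0 1) = 3 := by
  have h := integral_comp_abs (f := fun x : ℝ => x ^ 4 * Real.exp (-(x ^ 2) / 2))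
  simp only [sq_abs, (by norm_num : Even 4).pow_abs] at h
  rw [integral_pow_mul_exp_neg_sq_div_two] at h
  rw [integral_gaussianReal_eq_integral_smul one_ne_zero]
  simp only [gaussianPDFReal_def, smul_eq_mul, NNReal.coe_one, mul_one, sub_zero]
  have e : ∀ x : ℝ, (√(2 * Real.pi))⁻¹ * Real.exp (-x ^ 2 / 2) * x ^ 4 =
      (√(2 * Real.pi))⁻¹ * (x ^ 4 * Real.exp (-x ^ 2 / 2)) := fun x => by ring
  simp only [e]
  rw [integral_const_mul, h]
  have h1 : (1 / 2 : ℝ) ^ (-((4 : ℕ) + 1 : ℝ) / 2) = 4 * √2 := by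
    rw [show (-((4 : ℕ) + 1 : ℝ) / 2) = -((2 : ℕ) + 1 / 2) by norm_num, one_div,
      Real.inv_rpow (by norm_num), Real.rpow_neg (by norm_num), inv_inv,
      Real.rpow_add (by norm_num), Real.rpow_natCast, ← one_div, ← Real.sqrt_eq_rpow]
    norm_num
  have h2 : Real.Gamma (((4 : ℕ) + 1 : ℝ) / 2) = 3 / 4 * √Real.pi := by
    rw [show (((4 : ℕ) + 1 : ℝ) / 2) = (1 / 2 + 1) + 1 by norm_num,
      Real.Gamma_add_one (by norm_num), Real.Gamma_add_one (by norm_num), Real.Gamma_one_half_eq]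
    ring
  rw [h1, h2, Real.sqrt_mul (by norm_num)]
  have := Real.pi_pos
  field_simp

/-- Scaling also covers variance 0, where there is no density; biases initialised at 0 are of this
kind. -/
lemma gaussianReal_eq_map_sqrt_mul (v : ℝ≥0) :
    gaussianReal 0 v = (gaussianReal 0 1).map (√(v : ℝ) * ·) := by
  rw [gaussianReal_map_const_mul]
  congr 1
  · simp
  · ext
    simp

lemma integral_pow_four_gaussianReal (v : ℝ≥0) :
    ∫ x, x ^ 4 ∂(gaussianReal 0 v) = 3 * (v : ℝ) ^ 2 := by
  rw [gaussianReal_eq_map_sqrt_mul, integral_map (by fun_prop) (by fun_prop)]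
  simp only [mul_pow]
  rw [integral_const_mul, integral_pow_four_gaussianReal_one,
    show √(v : ℝ) ^ 4 = (√(v : ℝ) ^ 2) ^ 2 by ring, Real.sq_sqrt v.coe_nonneg, mul_comm]

end GaussianMoments

/-! ### Mixed moments of independent Gaussian coordinates. -/

section Isserlis

variable {ι : Type*} [Fintype ι]

/-- The law of a vector with independent centred Gaussian coordinates of variances `v i`. -/
noncomputable def gaussVec (v : ι → ℝ≥0) : Measure (EuclideanSpace ℝ ι) :=
  (Measure.pi fun i => gaussianReal 0 (v i)).map (WithLp.toLp 2)

instance (v : ι → ℝ≥0) : IsProbabilityMeasure (gaussVec v) :=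
  Measure.isProbabilityMeasure_map (by fun_prop)

lemma integrable_prod_pow_gaussVec (v : ι → ℝ≥0) (n : ι → ℕ) :
    Integrable (fun θ : EuclideanSpace ℝ ι => ∏ i, θ i ^ n i) (gaussVec v) := by
  rw [gaussVec, integrable_map_measure (by fun_prop) (by fun_prop)]
  exact Integrable.fintype_prod (f := fun i x => x ^ n i)
    fun i => integrable_pow_gaussianReal (v i) (n i)

lemma integral_prod_pow_gaussVec (v : ι → ℝ≥0) (n : ι → ℕ) :
    ∫ θ, ∏ i, θ i ^ n i ∂(gaussVec v) = ∏ i, ∫ x, x ^ n i ∂(gaussianReal 0 (v i)) := by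
  rw [gaussVec, integral_map (by fun_prop) (by fun_prop)]
  exact integral_fintype_prod_eq_prod (fun i x => x ^ n i)

/-- Collecting repeated indices into exponents turns any product of coordinates into a monomial,
whose integral factorises over the coordinates. -/
lemma mul_mul_mul_eq_prod_pow [DecidableEq ι] (x : ι → ℝ) (p q r s : ι) :
    x p * x q * x r * x s = ∏ i, x i ^ ((if i = p then 1 else 0) + (if i = q then 1 else 0) +
      (if i = r then 1 else 0) + (if i = s then 1 else 0)) := by
  simp only [pow_add, Finset.prod_mul_distrib, pow_ite, pow_one, pow_zero, Finset.prod_ite_eq',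
    Finset.mem_univ, if_true]

lemma mul_eq_prod_pow [DecidableEq ι] (x : ι → ℝ) (p q : ι) :
    x p * x q = ∏ i, x i ^ ((if i = p then 1 else 0) + (if i = q then 1 else 0)) := by
  simp only [pow_add, Finset.prod_mul_distrib, pow_ite, pow_one, pow_zero, Finset.prod_ite_eq',
    Finset.mem_univ, if_true]

lemma integrable_mul_mul_mul_gaussVec (v : ι → ℝ≥0) (p q r s : ι) :
    Integrable (fun θ : EuclideanSpace ℝ ι => θ p * θ q * θ r * θ s) (gaussVec v) := by
  classical
  simp_rw [mul_mul_mul_eq_prod_pow]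
  exact integrable_prod_pow_gaussVec v _

lemma integrable_mul_gaussVec (v : ι → ℝ≥0) (p q : ι) :
    Integrable (fun θ : EuclideanSpace ℝ ι => θ p * θ q) (gaussVec v) := by
  classical
  simp_rw [mul_eq_prod_pow]
  exact integrable_prod_pow_gaussVec v _

lemma integral_prod_pow_gaussVec_eq_zero (v : ι → ℝ≥0) {n : ι → ℕ} {i : ι} (hi : n i = 1) :
    ∫ θ, ∏ i, θ i ^ n i ∂(gaussVec v) = 0 := by
  rw [integral_prod_pow_gaussVec]
  exact Finset.prod_eq_zero (Finset.mem_univ i) (by simp [hi])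

lemma integral_mul_gaussVec [DecidableEq ι] (v : ι → ℝ≥0) (p q : ι) :
    ∫ θ, θ p * θ q ∂(gaussVec v) = if p = q then (v p : ℝ) else 0 := by
  simp_rw [mul_eq_prod_pow]
  split_ifs with h
  · subst h
    rw [integral_prod_pow_gaussVec, Finset.prod_eq_single p]
    · simpa using integral_pow_two_gaussianReal (v p)
    · intro i _ hi
      simp [hi]
    · simp
  · exact integral_prod_pow_gaussVec_eq_zero v (i := p) (by simp [h])

lemma integral_sq_mul_sq_gaussVec (v : ι → ℝ≥0) {p q : ι} (h : p ≠ q) {n : ι → ℕ}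
    (hp : n p = 2) (hq : n q = 2) (hn : ∀ i, i ≠ p → i ≠ q → n i = 0) :
    ∫ θ, ∏ i, θ i ^ n i ∂(gaussVec v) = v p * v q := by
  rw [integral_prod_pow_gaussVec, Finset.prod_eq_mul p q h]
  · rw [hp, hq, integral_pow_two_gaussianReal, integral_pow_two_gaussianReal]
  · intro i _ hi
    simp [hn i hi.1 hi.2]
  · simp
  · simp

/-- Isserlis' formula for fourth moments. -/
lemma integral_mul_mul_mul_gaussVec [DecidableEq ι] (v : ι → ℝ≥0) (p q r s : ι) :
    ∫ θ, θ p * θ q * θ r * θ s ∂(gaussVec v) =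
      (if p = q ∧ r = s then (v p : ℝ) * v r else 0) +
      (if p = r ∧ q = s then (v p : ℝ) * v q else 0) +
      (if p = s ∧ q = r then (v p : ℝ) * v q else 0) := by
  simp_rw [mul_mul_mul_eq_prod_pow]
  by_cases hpq : p = q
  · subst hpq
    by_cases hrs : r = s
    · subst hrs
      by_cases hpr : p = r
      · subst hpr
        rw [integral_prod_pow_gaussVec, Finset.prod_eq_single p]
        · simp only [if_true, and_self]
          rw [integral_pow_four_gaussianReal]
          ring
        · intro i _ hi
          simp [hi]
        · simp
      · rw [integral_sq_mul_sq_gaussVec v hpr (by simp [hpr]) (by simp [Ne.symm hpr])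
          (fun i h1 h2 => by simp [h1, h2])]
        simp [hpr]
    · by_cases hpr : p = r
      · subst hpr
        rw [integral_prod_pow_gaussVec_eq_zero v (i := s) (by simp [Ne.symm hrs])]
        simp [hrs]
      · rw [integral_prod_pow_gaussVec_eq_zero v (i := r) (by simp [Ne.symm hpr, hrs])]
        simp [hrs, hpr]
  · by_cases hpr : p = r
    · subst hpr
      by_cases hqs : q = s
      · subst hqs
        rw [integral_sq_mul_sq_gaussVec v hpq (by simp [hpq]) (by simp [Ne.symm hpq])
          (fun i h1 h2 => by simp [h1, h2])]
        simp [hpq]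
      · rw [integral_prod_pow_gaussVec_eq_zero v (i := q) (by simp [Ne.symm hpq, hqs])]
        simp [hpq, hqs, Ne.symm hpq]
    · by_cases hps : p = s
      · subst hps
        by_cases hqr : q = r
        · subst hqr
          rw [integral_sq_mul_sq_gaussVec v hpq (by simp [hpq]) (by simp [Ne.symm hpq])
            (fun i h1 h2 => by simp [h1, h2])]
          simp [hpq]
        · rw [integral_prod_pow_gaussVec_eq_zero v (i := q) (by simp [Ne.symm hpq, hqr])]
          simp [hpq, hqr, hpr]
      · rw [integral_prod_pow_gaussVec_eq_zero v (i := p) (by simp [hpq, hpr, hps])]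
        simp [hpq, hpr, hps]

end Isserlis

/-! ### Variance of a bilinear form in two rows of Gaussian weights. -/

section QuadraticForm

variable {ι κ : Type*} [Fintype ι] [Fintype κ]

/-- Second moment bound for a centred bilinear form in two (equal or disjoint) blocks of
independent standard normal variables. -/
lemma lintegral_sq_bilinear_sub_trace_le (v : ι → ℝ≥0) {e f : κ → ι} (he : e.Injective)
    (hf : f.Injective) (hve : ∀ a, v (e a) = 1) (hvf : ∀ a, v (f a) = 1)
    {δ : ℝ} (hef : (∀ a b, e a ≠ f b) ∧ δ = 0 ∨ e = f ∧ δ = 1) (A : κ → κ → ℝ) :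
    ∫⁻ θ, ENNReal.ofReal ((∑ a, ∑ b, A a b * (θ (e a) * θ (f b)) - δ * ∑ a, A a a) ^ 2)
      ∂(gaussVec v) ≤ ENNReal.ofReal (2 * ∑ a, ∑ b, A a b ^ 2) := by
  classical
  -- The number δ treats two cases at once: it is 1 when both rows coincide and 0 when they are
  -- disjoint.
  have h0 : ∀ a b, (if e a = f b then (1 : ℝ) else 0) = if a = b then δ else 0 := by
    intro a b
    rcases hef with ⟨h, h'⟩ | ⟨h, h'⟩
    · simp [h, h']
    · subst h
      simp [he.eq_iff, h']
  have hδ0 : 0 ≤ δ := by rcases hef with ⟨-, h⟩ | ⟨-, h⟩ <;> simp [h]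
  have hδ1 : δ ≤ 1 := by rcases hef with ⟨-, h⟩ | ⟨-, h⟩ <;> simp [h]
  have hδ2 : δ * δ = δ := by rcases hef with ⟨-, h⟩ | ⟨-, h⟩ <;> simp [h]
  have hcov : ∀ a b, ∫ θ, θ (e a) * θ (f b) ∂(gaussVec v) = if a = b then δ else 0 := by
    intro a b
    rw [integral_mul_gaussVec, hve, ← h0]
    simp
  have h4 : ∀ a b c d, ∫ θ, (θ (e a) * θ (f b)) * (θ (e c) * θ (f d)) ∂(gaussVec v) =
      (if a = b then δ else 0) * (if c = d then δ else 0) +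
      (if a = c ∧ b = d then 1 else 0) + (if a = d then δ else 0) * (if b = c then δ else 0) := by
    intro a b c d
    simp only [← mul_assoc]
    rw [integral_mul_mul_mul_gaussVec, ← h0, ← h0, ← h0,
      show (if b = c then δ else 0) = if c = b then δ else 0 by simp [eq_comm], ← h0]
    simp only [hve, hvf, he.eq_iff, hf.eq_iff, NNReal.coe_one, mul_one,
      eq_comm (a := f b), ite_zero_mul_ite_zero]
  have hi4 : ∀ a b c d, Integrable
      (fun θ : EuclideanSpace ℝ ι => (θ (e a) * θ (f b)) * (θ (e c) * θ (f d))) (gaussVec v) := by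
    intro a b c d
    simp only [← mul_assoc]
    exact integrable_mul_mul_mul_gaussVec v _ _ _ _
  have hi2 : ∀ a b, Integrable (fun θ : EuclideanSpace ℝ ι => θ (e a) * θ (f b)) (gaussVec v) :=
    fun a b => integrable_mul_gaussVec v _ _
  set E : κ × κ → EuclideanSpace ℝ ι → ℝ :=
    fun p θ => θ (e p.1) * θ (f p.2) - if p.1 = p.2 then δ else 0 with hE
  have hEmul : ∀ p q, (fun θ => E p θ * E q θ) = fun θ : EuclideanSpace ℝ ι =>
      (θ (e p.1) * θ (f p.2)) * (θ (e q.1) * θ (f q.2))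
      - ((θ (e p.1) * θ (f p.2)) * (if q.1 = q.2 then δ else 0)
        + ((θ (e q.1) * θ (f q.2)) * (if p.1 = p.2 then δ else 0)
          - (if p.1 = p.2 then δ else 0) * (if q.1 = q.2 then δ else 0))) := by
    intro p q
    funext θ
    simp only [hE]
    ring
  have hi1 : ∀ p q : κ × κ, Integrable (fun θ : EuclideanSpace ℝ ι =>
      (θ (e q.1) * θ (f q.2)) * (if p.1 = p.2 then δ else 0)
          - (if p.1 = p.2 then δ else 0) * (if q.1 = q.2 then δ else 0)) (gaussVec v) :=
    fun p q => ((hi2 _ _).mul_const _).sub (integrable_const _)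
  have hi3 : ∀ p q : κ × κ, Integrable (fun θ : EuclideanSpace ℝ ι =>
      (θ (e p.1) * θ (f p.2)) * (if q.1 = q.2 then δ else 0)
        + ((θ (e q.1) * θ (f q.2)) * (if p.1 = p.2 then δ else 0)
          - (if p.1 = p.2 then δ else 0) * (if q.1 = q.2 then δ else 0))) (gaussVec v) :=
    fun p q => ((hi2 _ _).mul_const _).add (hi1 p q)
  have hiEE : ∀ p q, Integrable (fun θ => E p θ * E q θ) (gaussVec v) := by
    intro p q
    rw [hEmul]
    exact (hi4 _ _ _ _).sub (hi3 p q)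
  -- After centring, the products have covariance identity plus δ times the transposition (a, b) ↦
  -- (b, a).
  have hEE : ∀ p q, ∫ θ, E p θ * E q θ ∂(gaussVec v) =
      (if p = q then 1 else 0) + (if p = q.swap then δ else 0) := by
    intro p q
    rw [hEmul, integral_sub (hi4 _ _ _ _) (hi3 p q), integral_add ((hi2 _ _).mul_const _) (hi1 p q),
      integral_sub ((hi2 _ _).mul_const _) (integrable_const _),
      integral_mul_const, integral_mul_const, hcov, hcov, h4]
    simp only [Prod.ext_iff, Prod.fst_swap, Prod.snd_swap, integral_const, probReal_univ,
      one_smul, ite_zero_mul_ite_zero, hδ2, and_comm (a := q.1 = q.2)]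
    ring
  have hsum : ∀ θ : EuclideanSpace ℝ ι,
      ∑ a, ∑ b, A a b * (θ (e a) * θ (f b)) - δ * ∑ a, A a a = ∑ p : κ × κ, A p.1 p.2 * E p θ := by
    intro θ
    rw [Fintype.sum_prod_type]
    simp only [hE, mul_sub, Finset.sum_sub_distrib]
    congr 1
    simp [Finset.mul_sum, mul_comm]
  have hsq : ∀ θ : EuclideanSpace ℝ ι,
      (∑ a, ∑ b, A a b * (θ (e a) * θ (f b)) - δ * ∑ a, A a a) ^ 2 =
        ∑ p : κ × κ, ∑ q : κ × κ, (A p.1 p.2 * A q.1 q.2) * (E p θ * E q θ) := by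
    intro θ
    rw [hsum, sq, Finset.sum_mul_sum]
    refine Finset.sum_congr rfl fun p _ => Finset.sum_congr rfl fun q _ => by ring
  simp only [hsq]
  rw [← ofReal_integral_eq_lintegral_ofReal
    (integrable_finsetSum _ fun p _ => integrable_finsetSum _ fun q _ =>
      (hiEE p q).const_mul _) (ae_of_all _ fun θ => by
        simp only [Pi.zero_apply, ← hsq]; positivity)]
  refine ENNReal.ofReal_le_ofReal ?_
  rw [integral_finsetSum _ fun p _ => integrable_finsetSum _ fun q _ =>
      (hiEE p q).const_mul _]
  simp_rw [integral_finsetSum _ fun q _ => (hiEE _ q).const_mul _, integral_const_mul, hEE]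
  have e1 : ∀ p : κ × κ, ∑ q : κ × κ, A p.1 p.2 * A q.1 q.2 *
      ((if p = q then 1 else 0) + if p = q.swap then δ else 0) =
      A p.1 p.2 ^ 2 + δ * (A p.1 p.2 * A p.2 p.1) := by
    intro p
    simp only [mul_add, Finset.sum_add_distrib]
    congr 1
    · simp [sq]
    · rw [Finset.sum_eq_single p.swap]
      · simp
        ring
      · intro q _ hq
        rw [if_neg, mul_zero]
        rintro rfl
        simp at hq
      · simp
  simp_rw [e1]
  have e2 : ∑ p : κ × κ, A p.2 p.1 ^ 2 = ∑ p : κ × κ, A p.1 p.2 ^ 2 :=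
    Fintype.sum_equiv (Equiv.prodComm κ κ) _ _ fun p => rfl
  -- The transposed term A_ab A_ba is absorbed by the arithmetic-geometric mean inequality; this
  -- gives the constant 2.
  have e3 : ∀ p : κ × κ, A p.1 p.2 ^ 2 + δ * (A p.1 p.2 * A p.2 p.1) ≤
      A p.1 p.2 ^ 2 + (A p.1 p.2 ^ 2 + A p.2 p.1 ^ 2) / 2 := by
    intro p
    have h1 : A p.1 p.2 * A p.2 p.1 ≤ (A p.1 p.2 ^ 2 + A p.2 p.1 ^ 2) / 2 := by
      nlinarith [sq_nonneg (A p.1 p.2 - A p.2 p.1)]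
    have h2 : 0 ≤ (A p.1 p.2 ^ 2 + A p.2 p.1 ^ 2) / 2 := by positivity
    nlinarith
  refine (Finset.sum_le_sum fun p _ => e3 p).trans (le_of_eq ?_)
  rw [Finset.sum_add_distrib, ← Finset.sum_div, Finset.sum_add_distrib, e2,
    ← Fintype.sum_prod_type' (f := fun a b => A a b ^ 2)]
  ring

end QuadraticForm

/-! ### Gaussian pairs with a given covariance, reduced to independent normals. -/

section GaussianPair

/-- `(X, Y)` is a centred Gaussian pair with variances `a`, `b` and covariance `c`. -/
structure IsGaussianPair {Ω : Type*} [MeasurableSpace Ω] (μ : Measure Ω) (X Y : Ω → ℝ)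
    (a b c : ℝ) : Prop where
  measurable_left : Measurable X
  measurable_right : Measurable Y
  map_eq : ∀ s t : ℝ, μ.map (fun ω => s * X ω + t * Y ω) =
    gaussianReal 0 (Real.toNNReal (s ^ 2 * a + t ^ 2 * b + 2 * (s * t) * c))

namespace IsGaussianPair

variable {Ω : Type*} [MeasurableSpace Ω] {μ : Measure Ω} {X Y : Ω → ℝ} {a b c : ℝ}

lemma map_left (h : IsGaussianPair μ X Y a b c) : μ.map X = gaussianReal 0 a.toNNReal := by
  simpa using h.map_eq 1 0

lemma map_right (h : IsGaussianPair μ X Y a b c) : μ.map Y = gaussianReal 0 b.toNNReal := by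
  simpa using h.map_eq 0 1

/-- This is the Cramér–Wold principle: the characteristic function of a pair sees only the laws of
its linear combinations, and `IsGaussianPair` prescribes these. -/
lemma map_prodMk_eq {Ω' : Type*} [MeasurableSpace Ω'] {μ' : Measure Ω'} [IsProbabilityMeasure μ]
    [IsProbabilityMeasure μ'] {X' Y' : Ω' → ℝ} (h : IsGaussianPair μ X Y a b c)
    (h' : IsGaussianPair μ' X' Y' a b c) :
    μ.map (fun ω => (X ω, Y ω)) = μ'.map (fun ω => (X' ω, Y' ω)) := by
  have hm := h.measurable_left.prodMk h.measurable_right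
  have hm' := h'.measurable_left.prodMk h'.measurable_right
  have := Measure.isProbabilityMeasure_map (μ := μ) hm.aemeasurable
  have := Measure.isProbabilityMeasure_map (μ := μ') hm'.aemeasurable
  refine Measure.ext_of_charFunDual (funext fun L => ?_)
  have hL : ∀ x y : ℝ, L (x, y) = L (1, 0) * x + L (0, 1) * y := by
    intro x y
    have : ((x, y) : ℝ × ℝ) = x • ((1, 0) : ℝ × ℝ) + y • ((0, 1) : ℝ × ℝ) := by simp
    rw [this, map_add, map_smul, map_smul, smul_eq_mul, smul_eq_mul]
    ring
  rw [charFunDual_eq_charFun_map_one, charFunDual_eq_charFun_map_one,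
    Measure.map_map (by fun_prop) hm, Measure.map_map (by fun_prop) hm']
  have e : (⇑L ∘ fun ω => (X ω, Y ω)) = fun ω => L (1, 0) * X ω + L (0, 1) * Y ω :=
    funext fun _ => hL _ _
  have e' : (⇑L ∘ fun ω => (X' ω, Y' ω)) = fun ω => L (1, 0) * X' ω + L (0, 1) * Y' ω :=
    funext fun _ => hL _ _
  rw [e, e', h.map_eq, h'.map_eq]

/-- This explicit model is the Cholesky factorisation of the covariance matrix with correlation c /
√(ab). -/
lemma gaussianReal_prod (a b c : ℝ) (ha : 0 < a) (hb : 0 < b) (hc : c ^ 2 ≤ a * b) :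
    IsGaussianPair ((gaussianReal 0 1).prod (gaussianReal 0 1)) (fun p => √a * p.1)
      (fun p => √b * (c / √(a * b) * p.1 + √(1 - (c / √(a * b)) ^ 2) * p.2)) a b c where
  measurable_left := by fun_prop
  measurable_right := by fun_prop
  map_eq s t := by
    set ρ := c / √(a * b)
    have hρ : √a * √b * ρ = c := by
      rw [← Real.sqrt_mul ha.le]
      exact mul_div_cancel₀ _ (by positivity)
    have hρ1 : ρ ^ 2 ≤ 1 := by
      rw [div_pow, Real.sq_sqrt (by positivity)]
      exact div_le_one_of_le₀ hc (by positivity)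
    set τ := √(1 - ρ ^ 2)
    have hτ : τ ^ 2 = 1 - ρ ^ 2 := Real.sq_sqrt (by linarith)
    have h1 := indepFun_prod (μ := gaussianReal 0 1) (ν := gaussianReal 0 1)
      (X := fun x : ℝ => (s * √a + t * √b * ρ) * x) (Y := fun x : ℝ => (t * √b * τ) * x)
      (by fun_prop) (by fun_prop)
    have hX : ((gaussianReal 0 1).prod (gaussianReal 0 1)).map
        (fun p : ℝ × ℝ => (s * √a + t * √b * ρ) * p.1) =
        gaussianReal ((s * √a + t * √b * ρ) * 0)
          (.mk ((s * √a + t * √b * ρ) ^ 2) (sq_nonneg _) * 1) := by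
      rw [← gaussianReal_map_const_mul]
      conv_rhs => rw [← (measurePreserving_fst (μ := gaussianReal 0 1)
        (ν := gaussianReal 0 1)).map_eq]
      rw [Measure.map_map (by fun_prop) (by fun_prop)]
      rfl
    have hY : ((gaussianReal 0 1).prod (gaussianReal 0 1)).map
        (fun p : ℝ × ℝ => (t * √b * τ) * p.2) =
        gaussianReal ((t * √b * τ) * 0) (.mk ((t * √b * τ) ^ 2) (sq_nonneg _) * 1) := by
      rw [← gaussianReal_map_const_mul]
      conv_rhs => rw [← (measurePreserving_snd (μ := gaussianReal 0 1)
        (ν := gaussianReal 0 1)).map_eq]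
      rw [Measure.map_map (by fun_prop) (by fun_prop)]
      rfl
    have h2 := gaussianReal_add_gaussianReal_of_indepFun h1 hX hY
    have e1 : (fun p : ℝ × ℝ => s * (√a * p.1) + t * (√b * (ρ * p.1 + τ * p.2))) =
        (fun p => (s * √a + t * √b * ρ) * p.1) + fun p => (t * √b * τ) * p.2 := by
      funext p
      simp only [Pi.add_apply]
      ring
    rw [e1, h2]
    have e2 : s ^ 2 * a + t ^ 2 * b + 2 * (s * t) * c =
        (s * √a + t * √b * ρ) ^ 2 + (t * √b * τ) ^ 2 := by
      have ha2 := Real.sq_sqrt ha.le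
      have hb2 := Real.sq_sqrt hb.le
      rw [mul_pow (t * √b) τ, hτ]
      linear_combination (-s ^ 2) * ha2 + (-t ^ 2) * hb2 - (2 * s * t) * hρ
    congr 1
    · simp
    · rw [e2]
      ext
      rw [Real.coe_toNNReal _ (by positivity)]
      simp

lemma integral_comp_eq [IsProbabilityMeasure μ] (h : IsGaussianPair μ X Y a b c)
    (ha : 0 < a) (hb : 0 < b)
    (hc : c ^ 2 ≤ a * b) {φ : ℝ × ℝ → ℝ} (hφ : Measurable φ) :
    ∫ ω, φ (X ω, Y ω) ∂μ = ∫ p, φ (√a * p.1, √b * (c / √(a * b) * p.1 +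
      √(1 - (c / √(a * b)) ^ 2) * p.2)) ∂((gaussianReal 0 1).prod (gaussianReal 0 1)) := by
  have h' := gaussianReal_prod a b c ha hb hc
  rw [← integral_map (h.measurable_left.prodMk h.measurable_right).aemeasurable
    hφ.aestronglyMeasurable, ← integral_map
    (h'.measurable_left.prodMk h'.measurable_right).aemeasurable hφ.aestronglyMeasurable,
    h.map_prodMk_eq h']

lemma correlation_mem_Icc (hc : c ^ 2 ≤ a * b) :
    c / √(a * b) ∈ Set.Icc (-1) 1 := by
  rw [Set.mem_Icc, ← abs_le, abs_div, abs_of_nonneg (Real.sqrt_nonneg _)]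
  exact div_le_one_of_le₀ (Real.abs_le_sqrt hc) (Real.sqrt_nonneg _)

lemma integral_step_mul_step [IsProbabilityMeasure μ] (h : IsGaussianPair μ X Y a b c)
    (ha : 0 < a) (hb : 0 < b)
    (hc : c ^ 2 ≤ a * b) : ∫ ω, step (X ω) * step (Y ω) ∂μ = kappa0 (c / √(a * b)) / 2 := by
  rw [h.integral_comp_eq ha hb hc (φ := fun p => step p.1 * step p.2)
    ((measurable_step.comp measurable_fst).mul (measurable_step.comp measurable_snd)),
    ← NTK.integral_step_mul_step (correlation_mem_Icc hc)]
  simp only [step_mul_of_pos (Real.sqrt_pos.2 ha), step_mul_of_pos (Real.sqrt_pos.2 hb)]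

lemma integral_relu_mul_relu [IsProbabilityMeasure μ] (h : IsGaussianPair μ X Y a b c)
    (ha : 0 < a) (hb : 0 < b)
    (hc : c ^ 2 ≤ a * b) :
    ∫ ω, relu (X ω) * relu (Y ω) ∂μ = √(a * b) * kappa1 (c / √(a * b)) / 2 := by
  rw [h.integral_comp_eq ha hb hc (φ := fun p => relu p.1 * relu p.2)
    ((measurable_relu.comp measurable_fst).mul (measurable_relu.comp measurable_snd)),
    mul_div_assoc, ← NTK.integral_relu_mul_relu (correlation_mem_Icc hc),
    ← integral_const_mul, Real.sqrt_mul ha.le]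
  simp only [relu_mul_of_nonneg (Real.sqrt_nonneg _)]
  congr 1
  funext p
  ring

/-- Since relu² is at most the square, X²Y² ≤ (X⁴ + Y⁴)/2 reduces this to the fourth moments 3a² and
3b². -/
lemma integrable_relu_mul_relu_sq_and_integral_le (h : IsGaussianPair μ X Y a b c) (ha : 0 ≤ a)
    (hb : 0 ≤ b) : Integrable (fun ω => (relu (X ω) * relu (Y ω)) ^ 2) μ ∧
      ∫ ω, (relu (X ω) * relu (Y ω)) ^ 2 ∂μ ≤ 3 / 2 * (a ^ 2 + b ^ 2) := by
  have hX := h.measurable_left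
  have hY := h.measurable_right
  have hX4 : Integrable (fun ω => X ω ^ 4) μ := by
    have := integrable_pow_gaussianReal a.toNNReal 4
    rwa [← h.map_left, integrable_map_measure (by fun_prop) (by fun_prop)] at this
  have hY4 : Integrable (fun ω => Y ω ^ 4) μ := by
    have := integrable_pow_gaussianReal b.toNNReal 4
    rwa [← h.map_right, integrable_map_measure (by fun_prop) (by fun_prop)] at this
  have hXi : ∫ ω, X ω ^ 4 ∂μ = 3 * a ^ 2 := by
    have := integral_pow_four_gaussianReal a.toNNReal
    rwa [← h.map_left, integral_map (by fun_prop) (by fun_prop), Real.coe_toNNReal _ ha] at this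
  have hYi : ∫ ω, Y ω ^ 4 ∂μ = 3 * b ^ 2 := by
    have := integral_pow_four_gaussianReal b.toNNReal
    rwa [← h.map_right, integral_map (by fun_prop) (by fun_prop), Real.coe_toNNReal _ hb] at this
  have hle : ∀ ω, (relu (X ω) * relu (Y ω)) ^ 2 ≤ 1 / 2 * (X ω ^ 4 + Y ω ^ 4) := by
    intro ω
    have h1 : relu (X ω) ^ 2 * relu (Y ω) ^ 2 ≤ X ω ^ 2 * Y ω ^ 2 :=
      mul_le_mul (relu_sq_le _) (relu_sq_le _) (sq_nonneg _) (sq_nonneg _)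
    nlinarith [sq_nonneg (X ω ^ 2 - Y ω ^ 2)]
  have hint : Integrable (fun ω => 1 / 2 * (X ω ^ 4 + Y ω ^ 4)) μ := (hX4.add hY4).const_mul _
  have hm : Measurable fun ω => (relu (X ω) * relu (Y ω)) ^ 2 :=
    ((measurable_relu.comp hX).mul (measurable_relu.comp hY)).pow_const 2
  have hi : Integrable (fun ω => (relu (X ω) * relu (Y ω)) ^ 2) μ :=
    hint.mono' hm.aestronglyMeasurable (ae_of_all _ fun ω => by
      rw [Real.norm_eq_abs, abs_of_nonneg (sq_nonneg _)]
      exact hle ω)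
  refine ⟨hi, (integral_mono hi hint hle).trans (le_of_eq ?_)⟩
  rw [integral_const_mul, integral_add hX4 hY4, hXi, hYi]
  ring

end IsGaussianPair

end GaussianPair

/-! ### A quantitative law of large numbers for the neurons of one layer. -/

section LawOfLargeNumbers

/-- Pairwise independence makes the variances add up. The normalisation 2/N, squared, gives the 4 in
the bound and matches the mean e/2. -/
lemma lintegral_sq_average_sub_le {Ω : Type*} [MeasurableSpace Ω] {μ : Measure Ω}
    [IsProbabilityMeasure μ] {N : ℕ} (hN : 0 < N) {Z : Fin N → Ω → ℝ}
    (hZm : ∀ j, Measurable (Z j)) (hZ : ∀ j, Integrable (fun ω => Z j ω ^ 2) μ)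
    (hind : Pairwise fun i j => IndepFun (Z i) (Z j) μ) {e B : ℝ} (he : ∀ j, ∫ ω, Z j ω ∂μ = e / 2)
    (hB : ∀ j, ∫ ω, Z j ω ^ 2 ∂μ ≤ B) :
    ∫⁻ ω, ENNReal.ofReal ((2 / N * ∑ j, Z j ω - e) ^ 2) ∂μ ≤ ENNReal.ofReal (4 * B / N) := by
  have hN' : (0 : ℝ) < N := by exact_mod_cast hN
  have hL2 : ∀ j, MemLp (Z j) 2 μ := fun j =>
    (memLp_two_iff_integrable_sq (hZm j).aestronglyMeasurable).2 (hZ j)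
  have hS2 : MemLp (∑ j, Z j) 2 μ := memLp_finsetSum' _ fun j _ => hL2 j
  have hmean : ∫ ω, (∑ j, Z j) ω ∂μ = N * e / 2 := by
    simp only [Finset.sum_apply]
    rw [integral_finsetSum _ fun j _ => (hL2 j).integrable one_le_two]
    simp [he]
    ring
  have hpt : ∀ ω, (2 / N * ∑ j, Z j ω - e) ^ 2 =
      4 / (N : ℝ) ^ 2 * ((∑ j, Z j) ω - ∫ ω, (∑ j, Z j) ω ∂μ) ^ 2 := by
    intro ω
    rw [hmean, Finset.sum_apply]
    field_simp
    ring
  simp only [hpt]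
  have hint : Integrable (fun ω => ((∑ j, Z j) ω - ∫ ω, (∑ j, Z j) ω ∂μ) ^ 2) μ :=
    (hS2.sub (memLp_const _)).integrable_sq
  rw [← ofReal_integral_eq_lintegral_ofReal (hint.const_mul _) (ae_of_all _ fun ω => by
      simp only [Pi.zero_apply]; positivity)]
  refine ENNReal.ofReal_le_ofReal ?_
  rw [integral_const_mul, ← variance_eq_integral hS2.aestronglyMeasurable.aemeasurable,
    IndepFun.variance_sum (fun j _ => hL2 j) (fun i _ j _ hij => hind hij)]
  have hv : ∀ j, variance (Z j) μ ≤ B := fun j =>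
    (variance_le_expectation_sq (hZm j).aestronglyMeasurable).trans (hB j)
  calc 4 / (N : ℝ) ^ 2 * ∑ j, variance (Z j) μ ≤ 4 / (N : ℝ) ^ 2 * ∑ _j : Fin N, B := by
        gcongr with j
        exact hv j
    _ = 4 * B / N := by
        simp only [Finset.sum_const, Finset.card_univ, Fintype.card_fin, nsmul_eq_mul]
        field_simp

variable {ι κ : Type*} [Fintype ι] [Fintype κ]

/-- Extending u by zero turns the sum into an inner product with a fixed vector, so its
characteristic function is that of the product law along this vector. -/
lemma map_sum_mul_gaussVec (v : ι → ℝ≥0) {e : κ → ι} (he : e.Injective) (u : κ → ℝ) :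
    (gaussVec v).map (fun θ => ∑ k, θ (e k) * u k) =
      gaussianReal 0 (Real.toNNReal (∑ k, v (e k) * u k ^ 2)) := by
  classical
  set t : EuclideanSpace ℝ ι := WithLp.toLp 2 (Function.extend e u 0) with ht
  have hte : ∀ k, t (e k) = u k := fun k => he.extend_apply _ _ _
  have ht0 : ∀ i, i ∉ Set.range e → t i = 0 := fun i hi =>
    Function.extend_apply' _ _ _ (by simpa using hi)
  have h1 : ∀ θ : EuclideanSpace ℝ ι, ∑ k, θ (e k) * u k = inner ℝ θ t := by
    intro θ
    rw [PiLp.inner_apply]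
    refine Fintype.sum_of_injective e he _ _ (fun i hi => ?_) (fun k => ?_)
    · simp [ht0 i hi]
    · simp [hte, mul_comm]
  have h2 : ∑ k, v (e k) * u k ^ 2 = ∑ i, v i * t i ^ 2 := by
    refine Fintype.sum_of_injective e he _ _ (fun i hi => ?_) (fun k => ?_)
    · simp [ht0 i hi]
    · simp [hte]
  simp only [h1, h2]
  have := Measure.isProbabilityMeasure_map (μ := gaussVec v)
    (f := fun θ => inner ℝ θ t) (by fun_prop)
  refine Measure.ext_of_charFun (funext fun s => ?_)
  have h3 : charFun ((gaussVec v).map (fun θ => inner ℝ θ t)) s = charFun (gaussVec v) (s • t) := by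
    rw [charFun_apply, charFun_apply, integral_map (by fun_prop) (by fun_prop)]
    simp [real_inner_smul_right]
  rw [h3, gaussVec, charFun_pi]
  simp only [charFun_gaussianReal]
  rw [← Complex.exp_sum]
  congr 1
  have hnn : 0 ≤ ∑ i, (v i : ℝ) * t i ^ 2 := Finset.sum_nonneg fun i _ => by positivity
  rw [Real.coe_toNNReal _ hnn]
  push_cast
  simp only [PiLp.smul_apply, smul_eq_mul, Complex.ofReal_mul, mul_zero,
    zero_mul, zero_sub, Finset.sum_neg_distrib, Finset.sum_mul, Finset.sum_div]
  congr 1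
  refine Finset.sum_congr rfl fun i _ => by ring

lemma isGaussianPair_gaussVec (v : ι → ℝ≥0) {e : κ → ι} (he : e.Injective) (u u' : κ → ℝ) :
    IsGaussianPair (gaussVec v) (fun θ => ∑ k, θ (e k) * u k) (fun θ => ∑ k, θ (e k) * u' k)
      (∑ k, v (e k) * u k ^ 2) (∑ k, v (e k) * u' k ^ 2) (∑ k, v (e k) * (u k * u' k)) where
  measurable_left := by fun_prop
  measurable_right := by fun_prop
  map_eq s t := by
    have h := map_sum_mul_gaussVec v he (fun k => s * u k + t * u' k)
    have e1 : ∀ θ : EuclideanSpace ℝ ι, ∑ k, θ (e k) * (s * u k + t * u' k) =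
        s * ∑ k, θ (e k) * u k + t * ∑ k, θ (e k) * u' k := by
      intro θ
      rw [Finset.mul_sum, Finset.mul_sum, ← Finset.sum_add_distrib]
      exact Finset.sum_congr rfl fun k _ => by ring
    have e2 : ∑ k, v (e k) * (s * u k + t * u' k) ^ 2 = s ^ 2 * ∑ k, v (e k) * u k ^ 2 +
        t ^ 2 * ∑ k, v (e k) * u' k ^ 2 + 2 * (s * t) * ∑ k, v (e k) * (u k * u' k) := by
      rw [Finset.mul_sum, Finset.mul_sum, Finset.mul_sum, ← Finset.sum_add_distrib,
        ← Finset.sum_add_distrib]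
      exact Finset.sum_congr rfl fun k _ => by ring
    simpa only [e1, e2] using h

lemma iIndepFun_gaussVec (v : ι → ℝ≥0) :
    iIndepFun (fun (i : ι) (θ : EuclideanSpace ℝ ι) => θ i) (gaussVec v) := by
  have h1 : (gaussVec v).map (fun θ i => θ i) = Measure.pi fun i => gaussianReal 0 (v i) := by
    rw [gaussVec, Measure.map_map (by fun_prop) (by fun_prop)]
    exact Measure.map_id
  rw [iIndepFun_iff_map_fun_eq_pi_map (by fun_prop), h1]
  congr 1
  funext i
  rw [← (measurePreserving_eval (fun i => gaussianReal 0 (v i)) i).map_eq, ← h1,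
    Measure.map_map (by fun_prop) (by fun_prop)]
  rfl

variable {N : ℕ}

/-- Different neurons read disjoint sets of coordinates. -/
lemma indepFun_rows_gaussVec (v : ι → ℝ≥0) {e : Fin N → κ → ι}
    (he : Function.Injective fun p : Fin N × κ => e p.1 p.2) (u u' : κ → ℝ) {φ : ℝ × ℝ → ℝ}
    (hφ : Measurable φ) {i j : Fin N} (hij : i ≠ j) :
    IndepFun (fun θ : EuclideanSpace ℝ ι => φ (∑ k, θ (e i k) * u k, ∑ k, θ (e i k) * u' k))
      (fun θ => φ (∑ k, θ (e j k) * u k, ∑ k, θ (e j k) * u' k)) (gaussVec v) := by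
  classical
  have hdisj : Disjoint (Finset.univ.image (e i)) (Finset.univ.image (e j)) := by
    rw [Finset.disjoint_left]
    intro a ha hb
    simp only [Finset.mem_image, Finset.mem_univ, true_and] at ha hb
    obtain ⟨k, rfl⟩ := ha
    obtain ⟨k', hk'⟩ := hb
    exact hij (congrArg Prod.fst (he (a₁ := (j, k')) (a₂ := (i, k)) hk')).symm
  have h := (iIndepFun_gaussVec v).indepFun_finset _ _ hdisj (fun i => by fun_prop)
  have hm : ∀ j : Fin N, Measurable fun x : (Finset.univ.image (e j)) → ℝ =>
      φ (∑ k, x ⟨e j k, by simp⟩ * u k, ∑ k, x ⟨e j k, by simp⟩ * u' k) :=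
    fun j => hφ.comp (by fun_prop)
  exact h.comp (hm i) (hm j)

lemma lintegral_sq_average_step_sub_le (v : ι → ℝ≥0) {e : Fin N → κ → ι}
    (he : Function.Injective fun p : Fin N × κ => e p.1 p.2) (u u' : κ → ℝ) {a b c : ℝ} (hN : 0 < N)
    (ha : ∀ j, ∑ k, v (e j k) * u k ^ 2 = a) (hb : ∀ j, ∑ k, v (e j k) * u' k ^ 2 = b)
    (hc : ∀ j, ∑ k, v (e j k) * (u k * u' k) = c) (ha0 : 0 < a) (hb0 : 0 < b)
    (hcab : c ^ 2 ≤ a * b) :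
    ∫⁻ θ, ENNReal.ofReal ((2 / N * ∑ j, step (∑ k, θ (e j k) * u k) * step (∑ k, θ (e j k) * u' k)
      - kappa0 (c / √(a * b))) ^ 2) ∂(gaussVec v) ≤ ENNReal.ofReal (4 * 1 / N) := by
  have hφ : Measurable fun p : ℝ × ℝ => step p.1 * step p.2 :=
    (measurable_step.comp measurable_fst).mul (measurable_step.comp measurable_snd)
  have hinj : ∀ j, (e j).Injective := fun j k k' h => (Prod.mk.inj (he (a₁ := (j, k))
    (a₂ := (j, k')) h)).2
  have hp : ∀ j, IsGaussianPair (gaussVec v) (fun θ => ∑ k, θ (e j k) * u k)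
      (fun θ => ∑ k, θ (e j k) * u' k) a b c := by
    intro j
    rw [← ha j, ← hb j, ← hc j]
    exact isGaussianPair_gaussVec v (hinj j) u u'
  have hm : ∀ j, Measurable fun θ : EuclideanSpace ℝ ι =>
      step (∑ k, θ (e j k) * u k) * step (∑ k, θ (e j k) * u' k) :=
    fun j => hφ.comp ((hp j).measurable_left.prodMk (hp j).measurable_right)
  have hle : ∀ x y, (step x * step y) ^ 2 ≤ 1 := fun x y => by
    have := mul_le_one₀ (step_le_one x) (step_nonneg y) (step_le_one y)
    have h0 := mul_nonneg (step_nonneg x) (step_nonneg y)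
    nlinarith
  have hi : ∀ j, Integrable (fun θ : EuclideanSpace ℝ ι =>
      (step (∑ k, θ (e j k) * u k) * step (∑ k, θ (e j k) * u' k)) ^ 2) (gaussVec v) := fun j =>
    (integrable_const (1 : ℝ)).mono' ((hm j).pow_const 2).aestronglyMeasurable
      (ae_of_all _ fun θ => by
        rw [Real.norm_eq_abs, abs_of_nonneg (sq_nonneg _)]
        exact hle _ _)
  refine lintegral_sq_average_sub_le hN hm hi (fun i j hij => ?_)
    (fun j => (hp j).integral_step_mul_step ha0 hb0 hcab) (fun j => ?_)
  · exact indepFun_rows_gaussVec v he u u' hφ hij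
  · refine (integral_mono (hi j) (integrable_const (1 : ℝ)) fun θ => hle _ _).trans ?_
    simp

lemma lintegral_sq_average_relu_sub_le (v : ι → ℝ≥0) {e : Fin N → κ → ι}
    (he : Function.Injective fun p : Fin N × κ => e p.1 p.2) (u u' : κ → ℝ) {a b c : ℝ} (hN : 0 < N)
    (ha : ∀ j, ∑ k, v (e j k) * u k ^ 2 = a) (hb : ∀ j, ∑ k, v (e j k) * u' k ^ 2 = b)
    (hc : ∀ j, ∑ k, v (e j k) * (u k * u' k) = c) (ha0 : 0 < a) (hb0 : 0 < b)
    (hcab : c ^ 2 ≤ a * b) :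
    ∫⁻ θ, ENNReal.ofReal ((2 / N * ∑ j, relu (∑ k, θ (e j k) * u k) * relu (∑ k, θ (e j k) * u' k)
      - √(a * b) * kappa1 (c / √(a * b))) ^ 2) ∂(gaussVec v) ≤
      ENNReal.ofReal (4 * (3 / 2 * (a ^ 2 + b ^ 2)) / N) := by
  have hφ : Measurable fun p : ℝ × ℝ => relu p.1 * relu p.2 :=
    (measurable_relu.comp measurable_fst).mul (measurable_relu.comp measurable_snd)
  have hinj : ∀ j, (e j).Injective := fun j k k' h => (Prod.mk.inj (he (a₁ := (j, k))
    (a₂ := (j, k')) h)).2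
  have hp : ∀ j, IsGaussianPair (gaussVec v) (fun θ => ∑ k, θ (e j k) * u k)
      (fun θ => ∑ k, θ (e j k) * u' k) a b c := by
    intro j
    rw [← ha j, ← hb j, ← hc j]
    exact isGaussianPair_gaussVec v (hinj j) u u'
  have hm : ∀ j, Measurable fun θ : EuclideanSpace ℝ ι =>
      relu (∑ k, θ (e j k) * u k) * relu (∑ k, θ (e j k) * u' k) :=
    fun j => hφ.comp ((hp j).measurable_left.prodMk (hp j).measurable_right)
  have hb := fun j => (hp j).integrable_relu_mul_relu_sq_and_integral_le ha0.le hb0.le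
  exact lintegral_sq_average_sub_le hN hm (fun j => (hb j).1)
    (fun i j hij => indepFun_rows_gaussVec v he u u' hφ hij)
    (fun j => (hp j).integral_relu_mul_relu ha0 hb0 hcab) (fun j => (hb j).2)

lemma gaussVec_sum_mul_eq_zero (v : ι → ℝ≥0) (u : κ → ℝ) {e : κ → ι} (he : e.Injective)
    (hu : 0 < ∑ k, v (e k) * u k ^ 2) :
    gaussVec v {θ | ∑ k, θ (e k) * u k = 0} = 0 := by
  have h := map_sum_mul_gaussVec v he u
  have := nullSingletonClass_gaussianReal (μ := 0) (Real.toNNReal_pos.2 hu).ne'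
  have h0 : (gaussVec v).map (fun θ => ∑ k, θ (e k) * u k) {0} = 0 := by
    rw [h]
    exact measure_singleton _
  rwa [Measure.map_apply (by fun_prop) (measurableSet_singleton _)] at h0

end LawOfLargeNumbers

/-! ### The gradient of the network and the recursion for its tangent kernel. -/

section Network

variable {d L : ℕ} {w : ℕ → ℕ}

/-- The output of the `i`-th affine map. -/
noncomputable def preact (θ : Params d L w) (x : EuclideanSpace ℝ (Fin d)) (i : ℕ) (h : i ≤ L) :
    Fin (layerDim d L w (i + 1)) → ℝ :=
  affine θ ⟨i, by omega⟩ (hidden θ x i h)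

lemma hidden_succ (θ : Params d L w) (x : EuclideanSpace ℝ (Fin d)) (i : ℕ) (h : i + 1 ≤ L)
    (j : Fin (layerDim d L w (i + 1))) :
    hidden θ x (i + 1) h j =
      relu (√2 * preact θ x i (by omega) j / √(layerDim d L w (i + 1) : ℝ)) := rfl

lemma layerDim_succ_of_lt {i : ℕ} (h : i < L) : layerDim d L w (i + 1) = w (i + 1) := by
  simp [layerDim, h]

/-- The parameters that enter the `j`-th output of the `i`-th affine map: `none` is the bias. -/
def rowIdx (i : ℕ) (h : i ≤ L) (j : Fin (layerDim d L w (i + 1))) :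
    Option (Fin (layerDim d L w i)) → ParamIdx d L w
  | some k => Sum.inl ⟨⟨i, by omega⟩, j, k⟩
  | none => Sum.inr ⟨⟨i, by omega⟩, j⟩

lemma rowIdx_injective (i : ℕ) (h : i ≤ L) :
    Function.Injective fun p : Fin (layerDim d L w (i + 1)) × Option (Fin (layerDim d L w i)) =>
      rowIdx i h p.1 p.2 := by
  rintro ⟨j, k⟩ ⟨j', k'⟩ hjk
  rcases k with _ | k <;> rcases k' with _ | k' <;> simp_all [rowIdx]

lemma rowIdx_inj {i : ℕ} {h : i ≤ L} {j j' : Fin (layerDim d L w (i + 1))}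
    {k k' : Option (Fin (layerDim d L w i))} :
    rowIdx i h j k = rowIdx i h j' k' ↔ j = j' ∧ k = k' := by
  rw [← Prod.mk.injEq]
  exact (rowIdx_injective i h).eq_iff (a := (j, k)) (b := (j', k'))

/-- The layer to which a parameter belongs. -/
def layerOf : ParamIdx d L w → ℕ
  | Sum.inl ⟨i, _⟩ => i
  | Sum.inr ⟨i, _⟩ => i

lemma layerOf_rowIdx (i : ℕ) (h : i ≤ L) (j : Fin (layerDim d L w (i + 1)))
    (k : Option (Fin (layerDim d L w i))) : layerOf (rowIdx i h j k) = i := by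
  rcases k with _ | k <;> rfl

/-- A vector with an additional entry `1` that multiplies the bias. -/
def augment {n : ℕ} (y : Fin n → ℝ) : Option (Fin n) → ℝ
  | some k => y k
  | none => 1

lemma preact_eq_sum (θ : Params d L w) (x : EuclideanSpace ℝ (Fin d)) (i : ℕ) (h : i ≤ L)
    (j : Fin (layerDim d L w (i + 1))) :
    preact θ x i h j = ∑ k, θ (rowIdx i h j k) * augment (hidden θ x i h) k := by
  rw [Fintype.sum_option]
  simp [preact, affine, weight, bias, augment, rowIdx, Matrix.mulVec, dotProduct, add_comm]

/-- The gradient of `preact θ x i h j` with respect to `θ`, if no neuron below layer `i` sits at the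
kink of the rectified linear unit. -/
noncomputable def gradPreact (θ : Params d L w) (x : EuclideanSpace ℝ (Fin d)) :
    (i : ℕ) → (h : i ≤ L) → Fin (layerDim d L w (i + 1)) → Params d L w
  | 0, h => fun j =>
      ∑ k, augment (hidden θ x 0 h) k • EuclideanSpace.single (rowIdx 0 h j k) (1 : ℝ)
  | i + 1, h => fun j =>
      ∑ k, augment (hidden θ x (i + 1) h) k • EuclideanSpace.single (rowIdx (i + 1) h j k) (1 : ℝ) +
      ∑ a, (θ (rowIdx (i + 1) h j (some a)) * (√2 / √(layerDim d L w (i + 1) : ℝ) *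
        step (preact θ x i (by omega) a))) • gradPreact θ x i (by omega) a

lemma hasDerivAt_relu {a : ℝ} (ha : a ≠ 0) : HasDerivAt relu (step a) a := by
  unfold step
  rcases ha.lt_or_gt with h | h
  · rw [if_neg h.not_gt]
    refine (hasDerivAt_const a (0 : ℝ)).congr_of_eventuallyEq ?_
    filter_upwards [eventually_lt_nhds h] with b hb
    simp [relu, hb.le]
  · rw [if_pos h]
    refine (hasDerivAt_id a).congr_of_eventuallyEq ?_
    filter_upwards [eventually_gt_nhds h] with b hb
    simp [relu, hb.le]

lemma hasFDerivAt_apply_param {ι : Type*} [Fintype ι] [DecidableEq ι] (θ : EuclideanSpace ℝ ι)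
    (p : ι) :
    HasFDerivAt (fun θ : EuclideanSpace ℝ ι => θ p)
      (innerSL ℝ (EuclideanSpace.single p (1 : ℝ))) θ := by
  have h := (EuclideanSpace.proj p : EuclideanSpace ℝ ι →L[ℝ] ℝ).hasFDerivAt (x := θ)
  convert! h using 1
  ext v
  simp [EuclideanSpace.inner_single_left]

lemma hasFDerivAt_preact (θ : Params d L w) (x : EuclideanSpace ℝ (Fin d)) (i : ℕ) (h : i ≤ L)
    (hne : ∀ (l : ℕ) (hl : l < i), ∀ a, preact θ x l (by omega) a ≠ 0)
    (j : Fin (layerDim d L w (i + 1))) :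
    HasFDerivAt (fun θ => preact θ x i h j) (innerSL ℝ (gradPreact θ x i h j)) θ := by
  induction i with
  | zero =>
    simp only [preact_eq_sum]
    have h1 := HasFDerivAt.fun_sum (u := Finset.univ) fun k _ =>
      (hasFDerivAt_apply_param θ (rowIdx 0 h j k)).mul_const (augment (hidden θ x 0 h) k)
    convert! h1 using 1
    ext v
    simp [gradPreact]
  | succ i ih =>
    simp only [preact_eq_sum]
    -- Widths are not assumed positive here; where the factor is needed, a neuron index shows that
    -- its layer is nonempty.
    have hN : 0 < layerDim d L w (i + 1) → 0 < √2 / √(layerDim d L w (i + 1) : ℝ) := fun hpos => by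
      positivity
    have hhid : ∀ a, HasFDerivAt (fun θ => hidden θ x (i + 1) h a)
        ((√2 / √(layerDim d L w (i + 1) : ℝ) * step (preact θ x i (by omega) a)) •
          innerSL ℝ (gradPreact θ x i (by omega) a)) θ := by
      intro a
      have hc := hN (Fin.pos a)
      simp only [hidden_succ, mul_div_right_comm]
      have h1 := (ih (by omega) (fun l hl => hne l (by omega)) a).const_mul
        (√2 / √(layerDim d L w (i + 1) : ℝ))
      have h2 := (hasDerivAt_relu (mul_ne_zero hc.ne' (hne i (by omega) a))).comp_hasFDerivAt θ h1
      rw [step_mul_of_pos hc, smul_smul, mul_comm] at h2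
      exact h2
    have haug : ∀ k, HasFDerivAt (fun θ => augment (hidden θ x (i + 1) h) k)
        (innerSL ℝ (k.elim 0 fun a => (√2 / √(layerDim d L w (i + 1) : ℝ) *
          step (preact θ x i (by omega) a)) • gradPreact θ x i (by omega) a)) θ := by
      rintro (_ | a)
      · simpa [augment] using hasFDerivAt_const (1 : ℝ) θ
      · simpa [augment] using hhid a
    have h1 := HasFDerivAt.fun_sum (u := Finset.univ) fun k _ =>
      (hasFDerivAt_apply_param θ (rowIdx (i + 1) h j k)).mul (haug k)
    convert! h1 using 1
    ext v
    simp only [gradPreact, Finset.sum_add_distrib, map_add]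
    simp only [Fintype.sum_option, Option.elim]
    simp [mul_assoc]
    ring

/-- The outputs of layer `i` do not involve parameters of later layers. This makes the two parts of
the gradient orthogonal in `layerNTK_succ`. -/
lemma gradPreact_apply_eq_zero (θ : Params d L w) (x : EuclideanSpace ℝ (Fin d)) (i : ℕ)
    (h : i ≤ L) (j : Fin (layerDim d L w (i + 1))) (p : ParamIdx d L w) (hp : i < layerOf p) :
    gradPreact θ x i h j p = 0 := by
  induction i with
  | zero =>
    simp only [gradPreact, WithLp.ofLp_sum, Finset.sum_apply, PiLp.smul_apply, smul_eq_mul]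
    refine Finset.sum_eq_zero fun k _ => ?_
    have : p ≠ rowIdx 0 h j k := by
      rintro rfl
      simp [layerOf_rowIdx] at hp
    simp [this]
  | succ i ih =>
    simp only [gradPreact, WithLp.ofLp_sum, WithLp.ofLp_add, Pi.add_apply, Finset.sum_apply,
      PiLp.smul_apply, smul_eq_mul]
    rw [Finset.sum_eq_zero fun k _ => ?_, Finset.sum_eq_zero fun a _ => ?_, add_zero]
    · rw [ih _ _ (by omega), mul_zero]
    · have : p ≠ rowIdx (i + 1) h j k := by
        rintro rfl
        simp [layerOf_rowIdx] at hp
      simp [this]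

/-- The neural tangent kernel of the outputs of the `i`-th affine map. -/
noncomputable def layerNTK (θ : Params d L w) (x x' : EuclideanSpace ℝ (Fin d)) (i : ℕ) (h : i ≤ L)
    (j k : Fin (layerDim d L w (i + 1))) : ℝ :=
  inner ℝ (gradPreact θ x i h j) (gradPreact θ x' i h k)

/-- The inner product of the inputs of the `i`-th affine map, plus the variance of its biases. -/
noncomputable def gram (θ : Params d L w) (x x' : EuclideanSpace ℝ (Fin d)) (i : ℕ) (h : i ≤ L) :
    ℝ :=
  ∑ k, hidden θ x i h k * hidden θ x' i h k + if i = 0 then 1 else 0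

/-- Every bias is a parameter of the gradient, so each layer contributes the extra 1, even where the
bias is initialised at 0. In layer 0 `gram` already contains it; in later layers it is the indicator
of l ≥ 1 in the limit. -/
lemma inner_sum_single_row (i : ℕ) (h : i ≤ L) (j k : Fin (layerDim d L w (i + 1)))
    (y y' : Fin (layerDim d L w i) → ℝ) :
    inner ℝ (∑ a, augment y a • EuclideanSpace.single (rowIdx i h j a) (1 : ℝ))
      (∑ a, augment y' a • EuclideanSpace.single (rowIdx i h k a) (1 : ℝ)) =
      if j = k then ∑ a, y a * y' a + 1 else 0 := by
  simp only [sum_inner, inner_sum, real_inner_smul_left, real_inner_smul_right,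
    EuclideanSpace.inner_single_left, PiLp.single_apply, rowIdx_inj, map_one, one_mul]
  split_ifs with hjk
  · simp [hjk, Fintype.sum_option, augment, add_comm, mul_comm]
  · simp [hjk]

lemma layerNTK_zero (θ : Params d L w) (x x' : EuclideanSpace ℝ (Fin d))
    (j k : Fin (layerDim d L w (0 + 1))) :
    layerNTK θ x x' 0 (Nat.zero_le L) j k =
      if j = k then gram θ x x' 0 (Nat.zero_le L) else 0 := by
  simp only [layerNTK, gradPreact, inner_sum_single_row, gram, if_true]

/-- The matrix of the bilinear form in the weights of layer `i + 1` that the tangent kernel of layer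
`i` contributes to that of layer `i + 1`. -/
noncomputable def transfer (θ : Params d L w) (x x' : EuclideanSpace ℝ (Fin d)) (i : ℕ) (h : i ≤ L)
    (a b : Fin (layerDim d L w (i + 1))) : ℝ :=
  2 / layerDim d L w (i + 1) * (step (preact θ x i h a) * step (preact θ x' i h b)) *
    layerNTK θ x x' i h a b

/-- The gradient splits orthogonally into a part along the parameters of layer `i + 1` and a part
along lower layers. The former gives the diagonal term, the latter a bilinear form in rows `j` and
`k` of the weights. -/
lemma layerNTK_succ (θ : Params d L w) (x x' : EuclideanSpace ℝ (Fin d)) (i : ℕ) (h : i + 1 ≤ L)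
    (j k : Fin (layerDim d L w (i + 1 + 1))) :
    layerNTK θ x x' (i + 1) h j k =
      (if j = k then gram θ x x' (i + 1) h + 1 else 0) +
      ∑ a, ∑ b, transfer θ x x' i (by omega) a b *
        (θ (rowIdx (i + 1) h j (some a)) * θ (rowIdx (i + 1) h k (some b))) := by
  have horth : ∀ y : EuclideanSpace ℝ (Fin d), ∀ a b p,
      inner ℝ (EuclideanSpace.single (rowIdx (i + 1) h b p) (1 : ℝ))
        (gradPreact θ y i (by omega) a) = 0 := by
    intro y a b p
    rw [EuclideanSpace.inner_single_left, gradPreact_apply_eq_zero _ _ _ _ _ _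
      (by rw [layerOf_rowIdx]; omega), mul_zero]
  have horth' : ∀ y : EuclideanSpace ℝ (Fin d), ∀ a b p, inner ℝ (gradPreact θ y i (by omega) a)
      (EuclideanSpace.single (rowIdx (i + 1) h b p) (1 : ℝ)) = 0 := by
    intro y a b p
    rw [real_inner_comm, horth]
  have h2 : √2 / √(layerDim d L w (i + 1) : ℝ) * (√2 / √(layerDim d L w (i + 1) : ℝ)) =
      2 / layerDim d L w (i + 1) := by
    rw [div_mul_div_comm, Real.mul_self_sqrt zero_le_two, Real.mul_self_sqrt (Nat.cast_nonneg _)]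
  rw [layerNTK, gradPreact, gradPreact, inner_add_left, inner_add_right, inner_add_right,
    inner_sum_single_row]
  simp only [sum_inner, inner_sum, real_inner_smul_left, real_inner_smul_right, horth, horth',
    mul_zero, Finset.sum_const_zero, add_zero, zero_add]
  congr 1
  · simp [gram]
  · refine (Finset.sum_comm).trans (Finset.sum_congr rfl fun a _ =>
      Finset.sum_congr rfl fun b _ => ?_)
    simp only [transfer, layerNTK, ← h2]
    ring

lemma differentiableAt_centredNet (θ₀ θ : Params d L w) (x : EuclideanSpace ℝ (Fin d))
    (hne : ∀ (l : ℕ) (hl : l < L), ∀ a, preact θ x l hl.le a ≠ 0) :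
    DifferentiableAt ℝ (fun ϑ => centredNet θ₀ ϑ x) θ :=
  ((hasFDerivAt_preact θ x L le_rfl hne ⟨0, by simp [layerDim]⟩).sub_const _).differentiableAt

lemma gradient_centredNet (θ₀ θ : Params d L w) (x : EuclideanSpace ℝ (Fin d))
    (hne : ∀ (l : ℕ) (hl : l < L), ∀ a, preact θ x l hl.le a ≠ 0) :
    gradient (fun ϑ => centredNet θ₀ ϑ x) θ =
      gradPreact θ x L le_rfl ⟨0, by simp [layerDim]⟩ := by
  refine HasGradientAt.gradient ?_
  rw [hasGradientAt_iff_hasFDerivAt]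
  exact (hasFDerivAt_preact θ x L le_rfl hne ⟨0, by simp [layerDim]⟩).sub_const _

lemma finiteNTK_eq_layerNTK (θ₀ θ : Params d L w) (x x' : EuclideanSpace ℝ (Fin d))
    (hne : ∀ (l : ℕ) (hl : l < L), ∀ a, preact θ x l hl.le a ≠ 0)
    (hne' : ∀ (l : ℕ) (hl : l < L), ∀ a, preact θ x' l hl.le a ≠ 0) :
    finiteNTK θ₀ θ x x' =
      layerNTK θ x x' L le_rfl ⟨0, by simp [layerDim]⟩ ⟨0, by simp [layerDim]⟩ := by
  rw [finiteNTK, gradient_centredNet _ _ _ hne, gradient_centredNet _ _ _ hne', layerNTK]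

end Network

/-! ### Which layers of parameters each quantity depends on. -/

section Locality

variable {d L : ℕ} {w : ℕ → ℕ} {θ θ' : Params d L w} (x x' : EuclideanSpace ℝ (Fin d))

/-- The inequality is strict: inputs of layer `i`, and with them `gram`, stay fixed when layer `i`
itself is resampled. -/
lemma hidden_congr (i : ℕ) (h : i ≤ L) (hθ : ∀ p, layerOf p < i → θ p = θ' p) :
    hidden θ x i h = hidden θ' x i h := by
  induction i with
  | zero => rfl
  | succ i ih =>
    funext j
    rw [hidden_succ, hidden_succ, preact_eq_sum, preact_eq_sum,
      ih (by omega) fun p hp => hθ p (by omega)]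
    congr 4
    funext k
    rw [hθ _ (by rw [layerOf_rowIdx]; omega)]

lemma preact_congr (i : ℕ) (h : i ≤ L) (hθ : ∀ p, layerOf p ≤ i → θ p = θ' p) :
    preact θ x i h = preact θ' x i h := by
  funext j
  rw [preact_eq_sum, preact_eq_sum, hidden_congr x i h fun p hp => hθ p hp.le]
  exact Finset.sum_congr rfl fun k _ => by rw [hθ _ (by rw [layerOf_rowIdx])]

lemma gradPreact_congr (i : ℕ) (h : i ≤ L) (hθ : ∀ p, layerOf p ≤ i → θ p = θ' p) :
    gradPreact θ x i h = gradPreact θ' x i h := by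
  induction i with
  | zero => rfl
  | succ i ih =>
    funext j
    simp only [gradPreact]
    rw [ih (by omega) fun p hp => hθ p (by omega), hidden_congr x (i + 1) h fun p hp => hθ p hp.le,
      preact_congr x i (by omega) fun p hp => hθ p (by omega)]
    congr 2
    funext a
    rw [hθ _ (by rw [layerOf_rowIdx])]

lemma gram_congr (i : ℕ) (h : i ≤ L) (hθ : ∀ p, layerOf p < i → θ p = θ' p) :
    gram θ x x' i h = gram θ' x x' i h := by
  rw [gram, gram, hidden_congr x i h hθ, hidden_congr x' i h hθ]

lemma transfer_congr (i : ℕ) (h : i ≤ L) (hθ : ∀ p, layerOf p ≤ i → θ p = θ' p) :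
    transfer θ x x' i h = transfer θ' x x' i h := by
  funext a b
  rw [transfer, transfer, layerNTK, layerNTK, preact_congr x i h hθ, preact_congr x' i h hθ,
    gradPreact_congr x i h hθ, gradPreact_congr x' i h hθ]

end Locality

/-! ### Measurability in the parameters. -/

section Measurability

variable {d L : ℕ} {w : ℕ → ℕ} (x x' : EuclideanSpace ℝ (Fin d))

lemma measurable_augment {α : Type*} [MeasurableSpace α] {n : ℕ} {y : α → Fin n → ℝ}
    (hy : ∀ k, Measurable fun t => y t k) (k : Option (Fin n)) :
    Measurable fun t => augment (y t) k := by
  rcases k with _ | k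
  · exact measurable_const
  · exact hy k

lemma measurable_hidden (i : ℕ) (h : i ≤ L) (j : Fin (layerDim d L w i)) :
    Measurable fun θ : Params d L w => hidden θ x i h j := by
  induction i with
  | zero => exact measurable_const
  | succ i ih =>
    simp only [hidden_succ, preact_eq_sum]
    exact measurable_relu.comp (((Finset.measurable_sum _ fun k _ => Measurable.mul (by fun_prop)
      (measurable_augment (fun k => ih (by omega) k) k)).const_mul _).div_const _)

lemma measurable_preact (i : ℕ) (h : i ≤ L) (j : Fin (layerDim d L w (i + 1))) :
    Measurable fun θ : Params d L w => preact θ x i h j := by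
  simp only [preact_eq_sum]
  exact Finset.measurable_sum _ fun k _ => Measurable.mul (by fun_prop)
    (measurable_augment (fun k => measurable_hidden x i h k) k)

lemma measurable_gradPreact (i : ℕ) (h : i ≤ L) (j : Fin (layerDim d L w (i + 1))) :
    Measurable fun θ : Params d L w => gradPreact θ x i h j := by
  induction i with
  | zero =>
    simp only [gradPreact]
    exact Finset.measurable_sum _ fun k _ =>
      (measurable_augment (fun k => measurable_hidden x 0 h k) k).smul_const _
  | succ i ih =>
    simp only [gradPreact]
    refine (Finset.measurable_sum _ fun k _ =>
      (measurable_augment (fun k => measurable_hidden x (i + 1) h k) k).smul_const _).add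
      (Finset.measurable_sum _ fun a _ => Measurable.fun_smul ?_ (ih (by omega) a))
    exact Measurable.mul (by fun_prop)
      ((measurable_step.comp (measurable_preact x i (by omega) a)).const_mul _)

lemma measurable_layerNTK (i : ℕ) (h : i ≤ L) (j k : Fin (layerDim d L w (i + 1))) :
    Measurable fun θ : Params d L w => layerNTK θ x x' i h j k :=
  (measurable_gradPreact x i h j).inner (measurable_gradPreact x' i h k)

lemma measurable_gram (i : ℕ) (h : i ≤ L) :
    Measurable fun θ : Params d L w => gram θ x x' i h :=
  (Finset.measurable_sum _ fun k _ => (measurable_hidden x i h k).mul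
    (measurable_hidden x' i h k)).add_const _

lemma measurable_transfer (i : ℕ) (h : i ≤ L) (a b : Fin (layerDim d L w (i + 1))) :
    Measurable fun θ : Params d L w => transfer θ x x' i h a b :=
  (((measurable_step.comp (measurable_preact x i h a)).mul
    (measurable_step.comp (measurable_preact x' i h b))).const_mul _).mul
    (measurable_layerNTK x x' i h a b)

end Measurability

/-! ### The initial law as a Gaussian vector, and resampling of one layer. -/

section Initialization

variable {d L : ℕ} {w : ℕ → ℕ}

/-- The variances of the parameters at initialization. -/
def initVar : ParamIdx d L w → ℝ≥0
  | Sum.inl _ => 1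
  | Sum.inr ⟨i, _⟩ => if i = 0 then 1 else 0

/-- The deterministic zero biases are Gaussians of variance 0, so all parameters are treated
uniformly. -/
lemma initLaw_eq_gaussVec : initLaw d L w = gaussVec (initVar (d := d) (L := L) (w := w)) := by
  have : (initCoord (d := d) (L := L) (w := w)) = fun p => gaussianReal 0 (initVar p) := by
    funext p
    rcases p with p | ⟨i, j⟩
    · rfl
    · simp only [initCoord, initVar]
      split_ifs
      · rfl
      · rw [gaussianReal_zero_var]
  rw [initLaw, this, gaussVec]

instance : IsProbabilityMeasure (initLaw d L w) := by
  rw [initLaw_eq_gaussVec]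
  infer_instance

/-- The left side is the conditional covariance of the pre-activations at `x` and `x'`; the bias
contributes its variance, which is nonzero only in layer 0. -/
lemma sum_initVar_mul_augment (i : ℕ) (h : i ≤ L) (j : Fin (layerDim d L w (i + 1)))
    (θ : Params d L w) (x x' : EuclideanSpace ℝ (Fin d)) :
    ∑ k, (initVar (rowIdx i h j k) : ℝ) *
      (augment (hidden θ x i h) k * augment (hidden θ x' i h) k) = gram θ x x' i h := by
  rw [Fintype.sum_option, gram, add_comm]
  congr 1
  · simp [initVar, rowIdx, augment]
  · simp only [initVar, rowIdx, augment, mul_one, Fin.ext_iff, Fin.val_zero]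
    split_ifs <;> simp

/-- Resampling of the parameters of layer `i`. -/
noncomputable def resampleLayer (i : ℕ) : Params d L w × Params d L w → Params d L w :=
  resample fun p => layerOf p = i

lemma measurePreserving_resampleLayer (i : ℕ) :
    MeasurePreserving (resampleLayer (d := d) (L := L) (w := w) i)
      ((initLaw d L w).prod (initLaw d L w)) (initLaw d L w) := by
  rw [initLaw_eq_gaussVec]
  exact measurePreserving_resample _ _

lemma resampleLayer_rowIdx (i : ℕ) (h : i ≤ L) (j : Fin (layerDim d L w (i + 1)))
    (k : Option (Fin (layerDim d L w i))) (q : Params d L w × Params d L w) :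
    resampleLayer i q (rowIdx i h j k) = q.2 (rowIdx i h j k) :=
  resample_of_mem (S := fun p => layerOf p = i) (layerOf_rowIdx i h j k) q

lemma resampleLayer_of_lt {i : ℕ} {p : ParamIdx d L w} (hp : layerOf p < i)
    (q : Params d L w × Params d L w) : resampleLayer i q p = q.1 p :=
  resample_of_notMem (S := fun p => layerOf p = i) hp.ne q

lemma preact_resampleLayer (i : ℕ) (h : i ≤ L) (x : EuclideanSpace ℝ (Fin d))
    (q : Params d L w × Params d L w) (j : Fin (layerDim d L w (i + 1))) :
    preact (resampleLayer i q) x i h j =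
      ∑ k, q.2 (rowIdx i h j k) * augment (hidden q.1 x i h) k := by
  rw [preact_eq_sum, hidden_congr x i h fun p hp => resampleLayer_of_lt hp q]
  simp only [resampleLayer_rowIdx]

end Initialization

/-! ### The limiting kernels and their recursion. -/

section Kernels

lemma continuous_kappa0 : Continuous kappa0 := by
  unfold kappa0
  exact continuous_const.mul (continuous_const.sub Real.continuous_arccos)

lemma continuous_kappa1 : Continuous kappa1 := by
  unfold kappa1
  exact continuous_const.mul ((by fun_prop : Continuous fun t : ℝ => √(1 - t ^ 2)).add
    (continuous_id.mul (continuous_const.sub Real.continuous_arccos)))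

lemma kappa1_one : kappa1 1 = 1 := by
  simp [kappa1]

variable {d : ℕ} (x x' : EuclideanSpace ℝ (Fin d))

lemma scale_self : scale x x = ‖x‖ ^ 2 + 1 := by
  rw [scale, ← sq, Real.sqrt_sq (by positivity)]

lemma scale_pos : 0 < scale x x' := by
  unfold scale
  positivity

lemma sqrt_scale_mul_scale : √(scale x x * scale x' x') = scale x x' := by
  rw [scale_self, scale_self, scale]

lemma uTilde_self : uTilde x x = 1 := by
  rw [uTilde, real_inner_self_eq_norm_sq, scale_self]
  exact div_self (by positivity)

/-- The limit of the Gram matrices of layer `i`. -/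
noncomputable def gramLimit (i : ℕ) : ℝ := scale x x' * kappa1^[i] (uTilde x x')

/-- Depth preserves the diagonal because 1 is a fixed point of `kappa1`; hence the correlations
never have a vanishing denominator in the limit. -/
lemma gramLimit_self (i : ℕ) : gramLimit x x i = scale x x := by
  rw [gramLimit, uTilde_self, Function.iterate_fixed kappa1_one, mul_one]

lemma gramLimit_div (i : ℕ) :
    gramLimit x x' i / √(gramLimit x x i * gramLimit x' x' i) = kappa1^[i] (uTilde x x') := by
  rw [gramLimit_self, gramLimit_self, sqrt_scale_mul_scale, gramLimit,
    mul_div_cancel_left₀ _ (scale_pos x x').ne']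

/-- The limit of the neural tangent kernel of the outputs of layer `i`. -/
noncomputable def ntkLimit (i : ℕ) : ℝ :=
  ∑ l ∈ Finset.range (i + 1), (scale x x' * kappa1^[l] (uTilde x x') + if 1 ≤ l then 1 else 0) *
    ∏ r ∈ Finset.Ico l i, kappa0 (kappa1^[r] (uTilde x x'))

lemma ntkLimit_zero : ntkLimit x x' 0 = gramLimit x x' 0 := by
  simp [ntkLimit, gramLimit]

/-- Each old summand gains the factor `kappa0` at r = i, and the new summand l = i + 1 has an empty
product. -/
lemma ntkLimit_succ (i : ℕ) : ntkLimit x x' (i + 1) =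
    ntkLimit x x' i * kappa0 (kappa1^[i] (uTilde x x')) + (gramLimit x x' (i + 1) + 1) := by
  rw [ntkLimit, Finset.sum_range_succ, Finset.Ico_self, Finset.prod_empty, mul_one,
    if_pos (by omega), gramLimit, ntkLimit, Finset.sum_mul]
  congr 1
  refine Finset.sum_congr rfl fun l hl => ?_
  rw [Finset.prod_Ico_succ_top (by simp at hl; omega), mul_assoc]

end Kernels

section Auxiliary

lemma tendsto_zero_of_sq {α : Type*} {F : Filter α} {f : α → ℝ}
    (h : Tendsto (fun p => f p ^ 2) F (𝓝 0)) : Tendsto f F (𝓝 0) := by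
  have h1 := (Real.continuous_sqrt.tendsto 0).comp h
  rw [Real.sqrt_zero] at h1
  rw [tendsto_zero_iff_abs_tendsto_zero]
  refine h1.congr fun p => ?_
  simp [Real.sqrt_sq_eq_abs]

lemma lintegral_ofReal_mul_sum_le {Ω α : Type*} [MeasurableSpace Ω] {μ : Measure Ω} [Fintype α]
    {f : α → Ω → ℝ} (hf : ∀ a ω, 0 ≤ f a ω) (hfm : ∀ a, Measurable (f a)) {c B : ℝ} (hc : 0 ≤ c)
    (hcα : c * Fintype.card α = 1) (hB : ∀ a, ∫⁻ ω, ENNReal.ofReal (f a ω) ∂μ ≤ ENNReal.ofReal B) :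
    ∫⁻ ω, ENNReal.ofReal (c * ∑ a, f a ω) ∂μ ≤ ENNReal.ofReal B := by
  simp_rw [ENNReal.ofReal_mul hc, ENNReal.ofReal_sum_of_nonneg fun a _ => hf a _]
  rw [lintegral_const_mul' _ _ ENNReal.ofReal_ne_top,
    lintegral_finsetSum _ fun a _ => (hfm a).ennreal_ofReal]
  calc ENNReal.ofReal c * ∑ a, ∫⁻ ω, ENNReal.ofReal (f a ω) ∂μ
      ≤ ENNReal.ofReal c * ∑ _a : α, ENNReal.ofReal B := by
        gcongr with a
        exact hB a
    _ = ENNReal.ofReal B := by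
        rw [Finset.sum_const, Finset.card_univ, nsmul_eq_mul, ← mul_assoc,
          ← ENNReal.ofReal_natCast, ← ENNReal.ofReal_mul hc, hcα, ENNReal.ofReal_one, one_mul]

end Auxiliary

/-! ### Convergence of the Gram matrices, and absence of neurons at the kink. -/

section Gram

variable {d L : ℕ}

/-- This is Cauchy–Schwarz for the hidden vectors with one more entry, 1 or 0, that accounts for the
bias variance. -/
lemma gram_sq_le {w : ℕ → ℕ} (θ : Params d L w) (x x' : EuclideanSpace ℝ (Fin d)) (i : ℕ)
    (h : i ≤ L) : gram θ x x' i h ^ 2 ≤ gram θ x x i h * gram θ x' x' i h := by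
  have e : ∀ y y' : EuclideanSpace ℝ (Fin d), gram θ y y' i h =
      ∑ k : Option (Fin (layerDim d L w i)), k.elim (if i = 0 then 1 else 0) (hidden θ y i h) *
        k.elim (if i = 0 then 1 else 0) (hidden θ y' i h) := by
    intro y y'
    rw [Fintype.sum_option, gram, add_comm]
    simp
  rw [e, e, e]
  simpa only [sq] using Finset.sum_mul_sq_le_sq_mul_sq Finset.univ
    (fun k : Option (Fin (layerDim d L w i)) => k.elim (if i = 0 then 1 else 0) (hidden θ x i h))
    (fun k => k.elim (if i = 0 then 1 else 0) (hidden θ x' i h))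

lemma gram_zero {w : ℕ → ℕ} (θ : Params d L w) (x x' : EuclideanSpace ℝ (Fin d)) :
    gram θ x x' 0 (Nat.zero_le L) = gramLimit x x' 0 := by
  have h1 : gram θ x x' 0 (Nat.zero_le L) = inner ℝ x x' + 1 := by
    rw [gram, PiLp.inner_apply, if_pos rfl]
    congr 1
    exact Finset.sum_congr rfl fun k _ => by simp [hidden, mul_comm]
  rw [h1, gramLimit, Function.iterate_zero, id_eq, uTilde, mul_div_cancel₀ _ (scale_pos x x').ne']

lemma gram_succ {w : ℕ → ℕ} (θ : Params d L w) (x x' : EuclideanSpace ℝ (Fin d)) (i : ℕ)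
    (h : i + 1 ≤ L) : gram θ x x' (i + 1) h = 2 / layerDim d L w (i + 1) *
      ∑ j, relu (preact θ x i (by omega) j) * relu (preact θ x' i (by omega) j) := by
  rw [gram, if_neg (by omega), add_zero, Finset.mul_sum]
  refine Finset.sum_congr rfl fun j _ => ?_
  rw [hidden_succ, hidden_succ, mul_div_right_comm, mul_div_right_comm,
    relu_mul_of_nonneg (by positivity), relu_mul_of_nonneg (by positivity), mul_mul_mul_comm,
    div_mul_div_comm, Real.mul_self_sqrt zero_le_two, Real.mul_self_sqrt (Nat.cast_nonneg _)]

variable {W : ℕ → ℕ → ℕ}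

/-- The filter of the events whose probability at initialization tends to `1`. -/
noncomputable abbrev initFilter (d L : ℕ) (W : ℕ → ℕ → ℕ) : Filter (Σ m, Params d L (W m)) :=
  probFilter fun m => initLaw d L (W m)

lemma eventually_layerDim_pos (hW : ∀ m, 1 ≤ m → ∀ i, 1 ≤ i → i ≤ L → m ≤ W m i) (i : ℕ) :
    ∀ᶠ p in initFilter d L W, 0 < layerDim d L (W p.1) (i + 1) := by
  filter_upwards [(tendsto_fst_probFilter _).eventually_ge_atTop 1] with p hp
  by_cases h : i < L
  · rw [layerDim_succ_of_lt h]
    exact hp.trans (hW _ hp _ (by omega) (by omega))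
  · simp [layerDim, h]

lemma tendsto_layerDim (hW : ∀ m, 1 ≤ m → ∀ i, 1 ≤ i → i ≤ L → m ≤ W m i) {i : ℕ} (h : i < L) :
    Tendsto (fun p => (layerDim d L (W p.1) (i + 1) : ℝ)) (initFilter d L W) atTop := by
  refine tendsto_natCast_atTop_atTop.comp
    (tendsto_atTop_mono' _ ?_ (tendsto_fst_probFilter fun m => initLaw d L (W m)))
  filter_upwards [(tendsto_fst_probFilter _).eventually_ge_atTop 1] with p hp
  rw [layerDim_succ_of_lt h]
  exact hW _ hp _ (by omega) (by omega)

variable {x x' : EuclideanSpace ℝ (Fin d)}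

lemma eventually_gram_pos {i : ℕ} {h : i ≤ L} (hG : Tendsto (fun p => gram p.2 x x i h)
      (initFilter d L W) (𝓝 (gramLimit x x i))) :
    ∀ᶠ p in initFilter d L W, 0 < gram p.2 x x i h := by
  rw [gramLimit_self] at hG
  exact hG.eventually_const_lt (scale_pos x x)

/-- Law of large numbers for averages over a layer, conditionally on the previous layers. -/
lemma tendsto_average {φ : ℝ → ℝ} (hφ : Measurable φ) {Ψ : ℝ → ℝ → ℝ → ℝ}
    (hΨ : Measurable fun q : ℝ × ℝ × ℝ => Ψ q.1 q.2.1 q.2.2) {B : ℝ → ℝ → ℝ}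
    (hB : Continuous fun q : ℝ × ℝ => B q.1 q.2) {i : ℕ} (h : i < L)
    (hW : ∀ m, 1 ≤ m → ∀ i, 1 ≤ i → i ≤ L → m ≤ W m i)
    (hG : ∀ y y' : EuclideanSpace ℝ (Fin d), Tendsto (fun p => gram p.2 y y' i h.le)
      (initFilter d L W) (𝓝 (gramLimit y y' i)))
    (hbound : ∀ (w : ℕ → ℕ) (θ : Params d L w), 0 < layerDim d L w (i + 1) →
      0 < gram θ x x i h.le → 0 < gram θ x' x' i h.le →
      ∫⁻ θ', ENNReal.ofReal ((2 / layerDim d L w (i + 1) * ∑ j,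
        φ (∑ k, θ' (rowIdx i h.le j k) * augment (hidden θ x i h.le) k) *
        φ (∑ k, θ' (rowIdx i h.le j k) * augment (hidden θ x' i h.le) k)
        - Ψ (gram θ x x i h.le) (gram θ x' x' i h.le) (gram θ x x' i h.le)) ^ 2) ∂(initLaw d L w) ≤
      ENNReal.ofReal (4 * B (gram θ x x i h.le) (gram θ x' x' i h.le) / layerDim d L w (i + 1)))
    {l : ℝ} (hl : Tendsto (fun p => Ψ (gram p.2 x x i h.le) (gram p.2 x' x' i h.le)
      (gram p.2 x x' i h.le)) (initFilter d L W) (𝓝 l)) :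
    Tendsto (fun p => 2 / layerDim d L (W p.1) (i + 1) *
      ∑ j, φ (preact p.2 x i h.le j) * φ (preact p.2 x' i h.le j)) (initFilter d L W) (𝓝 l) := by
  suffices hz : Tendsto (fun p => (2 / layerDim d L (W p.1) (i + 1) *
      ∑ j, φ (preact p.2 x i h.le j) * φ (preact p.2 x' i h.le j)
      - Ψ (gram p.2 x x i h.le) (gram p.2 x' x' i h.le) (gram p.2 x x' i h.le)) ^ 2)
      (initFilter d L W) (𝓝 0) by
    simpa using (tendsto_zero_of_sq hz).add hl
  -- Resampling layer `i` freezes the Gram entries, so Ψ is the fixed conditional mean. The variance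
  -- bound 4B / width tends to 0 because B converges along the filter.
  have hBl := ((hB.tendsto _).comp ((hG x x).prodMk_nhds (hG x' x'))).const_mul 4
  refine tendsto_zero_of_lintegral_resample (μ := fun m => initLaw d L (W m))
    (R := fun m => resampleLayer i) (fun m => measurePreserving_resampleLayer i)
    (fun p => sq_nonneg _) (fun m => ?_) (hBl.div_atTop (tendsto_layerDim hW h)) ?_
  · have h1 : ∀ y j, Measurable fun θ : Params d L (W m) => φ (preact θ y i h.le j) :=
      fun y j => hφ.comp (measurable_preact y i h.le j)
    have h2 : Measurable fun θ : Params d L (W m) =>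
        Ψ (gram θ x x i h.le) (gram θ x' x' i h.le) (gram θ x x' i h.le) :=
      hΨ.comp ((measurable_gram x x i h.le).prodMk ((measurable_gram x' x' i h.le).prodMk
        (measurable_gram x x' i h.le)))
    have h3 : Measurable fun θ : Params d L (W m) =>
        ∑ j, φ (preact θ x i h.le j) * φ (preact θ x' i h.le j) :=
      Finset.measurable_fun_sum _ fun j _ => (h1 x j).mul (h1 x' j)
    dsimp only
    exact ((h3.const_mul _).fun_sub h2).pow_const 2
  · filter_upwards [eventually_layerDim_pos hW i, eventually_gram_pos (hG x x),
      eventually_gram_pos (hG x' x')] with p hN hx hx'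
    refine le_trans (le_of_eq ?_) (hbound (W p.1) p.2 hN hx hx')
    refine lintegral_congr fun θ' => ?_
    have hc : ∀ y y' : EuclideanSpace ℝ (Fin d),
        gram (resampleLayer i (p.2, θ')) y y' i h.le = gram p.2 y y' i h.le :=
      fun y y' => gram_congr y y' i h.le fun q hq => resampleLayer_of_lt hq _
    simp only [preact_resampleLayer, hc]

lemma tendsto_average_step {i : ℕ} (h : i < L)
    (hW : ∀ m, 1 ≤ m → ∀ i, 1 ≤ i → i ≤ L → m ≤ W m i)
    (hG : ∀ y y' : EuclideanSpace ℝ (Fin d), Tendsto (fun p => gram p.2 y y' i h.le)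
      (initFilter d L W) (𝓝 (gramLimit y y' i))) :
    Tendsto (fun p => 2 / layerDim d L (W p.1) (i + 1) *
      ∑ j, step (preact p.2 x i h.le j) * step (preact p.2 x' i h.le j)) (initFilter d L W)
      (𝓝 (kappa0 (kappa1^[i] (uTilde x x')))) := by
  refine tendsto_average measurable_step (Ψ := fun a b c => kappa0 (c / √(a * b)))
    (B := fun _ _ => 1) ?_ continuous_const h hW hG ?_ ?_
  · have := continuous_kappa0.measurable
    fun_prop
  · intro w θ hN hx hx'
    rw [initLaw_eq_gaussVec]
    exact lintegral_sq_average_step_sub_le initVar (rowIdx_injective i h.le) _ _ hN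
      (fun j => by simpa only [sq] using sum_initVar_mul_augment i h.le j θ x x)
      (fun j => by simpa only [sq] using sum_initVar_mul_augment i h.le j θ x' x')
      (fun j => sum_initVar_mul_augment i h.le j θ x x') hx hx' (gram_sq_le θ x x' i h.le)
  · rw [← gramLimit_div]
    refine (continuous_kappa0.tendsto _).comp ((hG x x').div ((Real.continuous_sqrt.tendsto _).comp
      ((hG x x).mul (hG x' x'))) ?_)
    rw [gramLimit_self, gramLimit_self, sqrt_scale_mul_scale]
    exact (scale_pos x x').ne'

/-- The induction runs over all pairs of inputs, since the correlation at (x, x') also involves the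
entries at (x, x) and (x', x'). -/
lemma tendsto_gram (hW : ∀ m, 1 ≤ m → ∀ i, 1 ≤ i → i ≤ L → m ≤ W m i) (i : ℕ) (h : i ≤ L)
    (x x' : EuclideanSpace ℝ (Fin d)) :
    Tendsto (fun p => gram p.2 x x' i h) (initFilter d L W) (𝓝 (gramLimit x x' i)) := by
  induction i generalizing x x' with
  | zero =>
    simp only [gram_zero]
    exact tendsto_const_nhds
  | succ i ih =>
    have hG := ih (by omega)
    simp only [gram_succ]
    refine tendsto_average measurable_relu (Ψ := fun a b c => √(a * b) * kappa1 (c / √(a * b)))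
      (B := fun a b => 3 / 2 * (a ^ 2 + b ^ 2)) ?_ (by fun_prop) h hW hG ?_ ?_
    · have := continuous_kappa1.measurable
      fun_prop
    · intro w θ hN hx hx'
      rw [initLaw_eq_gaussVec]
      exact lintegral_sq_average_relu_sub_le initVar (rowIdx_injective i (Nat.le_of_lt h)) _ _ hN
        (fun j => by simpa only [sq] using sum_initVar_mul_augment i (Nat.le_of_lt h) j θ x x)
        (fun j => by simpa only [sq] using sum_initVar_mul_augment i (Nat.le_of_lt h) j θ x' x')
        (fun j => sum_initVar_mul_augment i (Nat.le_of_lt h) j θ x x') hx hx'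
        (gram_sq_le θ x x' i (Nat.le_of_lt h))
    · have hs := (Real.continuous_sqrt.tendsto _).comp ((hG x x).mul (hG x' x'))
      have hne : √(gramLimit x x i * gramLimit x' x' i) ≠ 0 := by
        rw [gramLimit_self, gramLimit_self, sqrt_scale_mul_scale]
        exact (scale_pos x x').ne'
      have := hs.mul ((continuous_kappa1.tendsto _).comp ((hG x x').div hs hne))
      rw [gramLimit_div] at this
      rw [gramLimit, Function.iterate_succ_apply']
      rwa [gramLimit_self, gramLimit_self, sqrt_scale_mul_scale] at this

/-- Given the lower layers, each pre-activation is Gaussian with variance `gram`, hence almost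
surely nonzero once this is positive. For `i ≥ 1` the bias is 0 and the whole hidden vector may
vanish, so positivity is only asserted with probability tending to 1. -/
lemma eventually_preact_ne_zero (hW : ∀ m, 1 ≤ m → ∀ i, 1 ≤ i → i ≤ L → m ≤ W m i) (i : ℕ)
    (h : i ≤ L) (x : EuclideanSpace ℝ (Fin d)) :
    ∀ᶠ p in initFilter d L W, ∀ a, preact p.2 x i h a ≠ 0 := by
  classical
  -- The indicator of the bad event has conditional expectation 0 as soon as the Gram entry is
  -- positive.
  have hz : Tendsto (fun p : Σ m, Params d L (W m) =>
      if ∃ a, preact p.2 x i h a = 0 then (1 : ℝ) else 0) (initFilter d L W) (𝓝 0) := by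
    refine tendsto_zero_of_lintegral_resample (μ := fun m => initLaw d L (W m))
      (R := fun m => resampleLayer i) (fun m => measurePreserving_resampleLayer i)
      (fun p => by split_ifs <;> simp) (fun m => ?_) (g := fun _ => 0) tendsto_const_nhds ?_
    · refine Measurable.ite ?_ measurable_const measurable_const
      have : {θ : Params d L (W m) | ∃ a, preact θ x i h a = 0} =
          ⋃ a, {θ | preact θ x i h a = 0} := by
        ext
        simp
      rw [this]
      exact MeasurableSet.iUnion fun a =>
        measurableSet_eq_fun (measurable_preact x i h a) measurable_const
    · filter_upwards [eventually_gram_pos (tendsto_gram hW i h x x)] with p hx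
      have hae : ∀ᵐ θ' ∂(initLaw d L (W p.1)),
          ∀ a, preact (resampleLayer i (p.2, θ')) x i h a ≠ 0 := by
        rw [ae_all_iff]
        intro a
        rw [ae_iff, initLaw_eq_gaussVec]
        simp only [preact_resampleLayer, not_not]
        refine gaussVec_sum_mul_eq_zero initVar _
          (fun k k' hk => (rowIdx_inj.1 hk).2) ?_
        simpa only [sq, sum_initVar_mul_augment] using hx
      rw [ENNReal.ofReal_zero, nonpos_iff_eq_zero]
      refine (lintegral_congr_ae (g := fun _ => 0) ?_).trans (by simp)
      filter_upwards [hae] with θ' hθ'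
      simp [hθ']
  filter_upwards [hz.eventually_lt_const one_pos] with p hp a ha
  rw [if_pos ⟨a, ha⟩] at hp
  exact lt_irrefl _ hp

end Gram

/-! ### Convergence of the tangent kernel by induction on the layer. -/

section TangentKernel

variable {d L : ℕ}

/-- The bilinear form in the weights of layer `i + 1` given by the transfer matrix, centred by its
conditional expectation. -/
noncomputable def centredForm {w : ℕ → ℕ} (θ : Params d L w) (x x' : EuclideanSpace ℝ (Fin d))
    (i : ℕ) (h : i + 1 ≤ L) (j k : Fin (layerDim d L w (i + 1 + 1))) : ℝ :=
  ∑ a, ∑ b, transfer θ x x' i (by omega) a b *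
    (θ (rowIdx (i + 1) h j (some a)) * θ (rowIdx (i + 1) h k (some b))) -
    (if j = k then 1 else 0) * ∑ a, transfer θ x x' i (by omega) a a

section

variable {w : ℕ → ℕ} (x x' : EuclideanSpace ℝ (Fin d)) (i : ℕ) (h : i + 1 ≤ L)
  (j k : Fin (layerDim d L w (i + 1 + 1)))

lemma layerNTK_succ_eq_centredForm (θ : Params d L w) :
    layerNTK θ x x' (i + 1) h j k = centredForm θ x x' i h j k +
      (if j = k then 1 else 0) *
        (gram θ x x' (i + 1) h + 1 + ∑ a, transfer θ x x' i (by omega) a a) := by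
  rw [layerNTK_succ, centredForm]
  split_ifs <;> ring

lemma measurable_centredForm :
    Measurable fun θ : Params d L w => centredForm θ x x' i h j k := by
  have h1 : ∀ a b, Measurable fun θ : Params d L w => transfer θ x x' i (by omega) a b :=
    measurable_transfer x x' i (by omega)
  unfold centredForm
  fun_prop

/-- The transfer matrix depends only on layers up to `i`, so under resampling of layer `i + 1` it is
a constant matrix in a Gaussian bilinear form. -/
lemma lintegral_sq_centredForm_le (θ : Params d L w) :
    ∫⁻ θ', ENNReal.ofReal (centredForm (resampleLayer (i + 1) (θ, θ')) x x' i h j k ^ 2)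
      ∂(initLaw d L w) ≤
      ENNReal.ofReal (2 * ∑ a, ∑ b, transfer θ x x' i (by omega) a b ^ 2) := by
  have hc : transfer (resampleLayer (i + 1) (θ, θ)) x x' i (by omega) =
      transfer θ x x' i (by omega) :=
    transfer_congr x x' i (by omega) fun p hp => resampleLayer_of_lt (by omega) _
  have hinj : ∀ j : Fin (layerDim d L w (i + 1 + 1)), Function.Injective
      fun a : Fin (layerDim d L w (i + 1)) => rowIdx (i + 1) h j (some a) := by
    intro j a a' haa
    simpa using (rowIdx_inj.1 haa).2
  have hb := lintegral_sq_bilinear_sub_trace_le (initVar (d := d) (L := L) (w := w))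
    (hinj j) (hinj k) (fun _ => rfl) (fun _ => rfl) (δ := if j = k then 1 else 0)
    (by
      by_cases hjk : j = k
      · exact Or.inr ⟨by rw [hjk], if_pos hjk⟩
      · exact Or.inl ⟨fun a b hab => hjk (rowIdx_inj.1 hab).1, if_neg hjk⟩)
    (transfer θ x x' i (by omega))
  rw [initLaw_eq_gaussVec]
  refine le_trans (le_of_eq (lintegral_congr fun θ' => ?_)) hb
  rw [centredForm, transfer_congr x x' i (by omega) (θ' := θ) fun p hp =>
    resampleLayer_of_lt (by omega) _]
  simp only [resampleLayer_rowIdx]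

lemma sum_transfer_sq_le (θ : Params d L w) (h : i ≤ L) :
    ∑ a, ∑ b, transfer θ x x' i h a b ^ 2 ≤
      4 * (1 / (layerDim d L w (i + 1) : ℝ) ^ 2 *
        ∑ q : Fin (layerDim d L w (i + 1)) × Fin (layerDim d L w (i + 1)),
          layerNTK θ x x' i h q.1 q.2 ^ 2) := by
  rw [← Fintype.sum_prod_type' (f := fun a b => transfer θ x x' i h a b ^ 2), ← mul_assoc,
    Finset.mul_sum]
  refine Finset.sum_le_sum fun q _ => ?_
  have h1 : (step (preact θ x i h q.1) * step (preact θ x' i h q.2)) ^ 2 ≤ 1 := by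
    refine pow_le_one₀ (mul_nonneg (step_nonneg _) (step_nonneg _)) ?_
    exact mul_le_one₀ (step_le_one _) (step_nonneg _) (step_le_one _)
  rw [transfer, mul_pow, mul_pow, div_pow]
  calc (2 : ℝ) ^ 2 / (layerDim d L w (i + 1) : ℝ) ^ 2 *
        (step (preact θ x i h q.1) * step (preact θ x' i h q.2)) ^ 2 *
          layerNTK θ x x' i h q.1 q.2 ^ 2
      ≤ (2 : ℝ) ^ 2 / (layerDim d L w (i + 1) : ℝ) ^ 2 * 1 *
          layerNTK θ x x' i h q.1 q.2 ^ 2 := by gcongr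
    _ = _ := by ring

/-- By Cauchy–Schwarz, replacing the diagonal kernel entries by a constant K costs (2/N)² · N = 4/N
times the sum of squared deviations. -/
lemma sq_trace_transfer_sub_le (θ : Params d L w) (h : i ≤ L) (hN : 0 < layerDim d L w (i + 1))
    (K : ℝ) :
    (∑ a, transfer θ x x' i h a a - K * (2 / layerDim d L w (i + 1) *
      ∑ a, step (preact θ x i h a) * step (preact θ x' i h a))) ^ 2 ≤
      4 * (1 / layerDim d L w (i + 1) * ∑ a, (layerNTK θ x x' i h a a - K) ^ 2) := by
  have hN' : (0 : ℝ) < layerDim d L w (i + 1) := by exact_mod_cast hN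
  have e : ∑ a, transfer θ x x' i h a a - K * (2 / layerDim d L w (i + 1) *
      ∑ a, step (preact θ x i h a) * step (preact θ x' i h a)) =
      2 / layerDim d L w (i + 1) * ∑ a, step (preact θ x i h a) * step (preact θ x' i h a) *
        (layerNTK θ x x' i h a a - K) := by
    simp only [transfer, Finset.mul_sum]
    rw [← Finset.sum_sub_distrib]
    exact Finset.sum_congr rfl fun a _ => by ring
  have h1 : (∑ a, step (preact θ x i h a) * step (preact θ x' i h a) *
      (layerNTK θ x x' i h a a - K)) ^ 2 ≤
      layerDim d L w (i + 1) * ∑ a, (layerNTK θ x x' i h a a - K) ^ 2 := by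
    refine (sq_sum_le_card_mul_sum_sq).trans ?_
    rw [Finset.card_univ, Fintype.card_fin]
    refine mul_le_mul_of_nonneg_left (Finset.sum_le_sum fun a _ => ?_) hN'.le
    have h2 : (step (preact θ x i h a) * step (preact θ x' i h a)) ^ 2 ≤ 1 := by
      refine pow_le_one₀ (mul_nonneg (step_nonneg _) (step_nonneg _)) ?_
      exact mul_le_one₀ (step_le_one _) (step_nonneg _) (step_le_one _)
    rw [mul_pow]
    exact mul_le_of_le_one_left (sq_nonneg _) h2
  rw [e, mul_pow]
  refine (mul_le_mul_of_nonneg_left h1 (sq_nonneg _)).trans (le_of_eq ?_)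
  field_simp
  ring

end

variable {W : ℕ → ℕ → ℕ} {x x' : EuclideanSpace ℝ (Fin d)}

/-- The diagonal of the tangent kernel of layer `i` converges in mean square. -/
def DiagConverges (W : ℕ → ℕ → ℕ) (x x' : EuclideanSpace ℝ (Fin d)) (i : ℕ) (h : i ≤ L) : Prop :=
  Tendsto (fun p => 1 / layerDim d L (W p.1) (i + 1) *
    ∑ j, (layerNTK p.2 x x' i h j j - ntkLimit x x' i) ^ 2) (initFilter d L W) (𝓝 0)

/-- The mean square of the entries of the tangent kernel of layer `i` tends to `0`. -/
def MeanSqVanishes (W : ℕ → ℕ → ℕ) (x x' : EuclideanSpace ℝ (Fin d)) (i : ℕ) (h : i ≤ L) : Prop :=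
  Tendsto (fun p => 1 / (layerDim d L (W p.1) (i + 1) : ℝ) ^ 2 *
    ∑ q : Fin (layerDim d L (W p.1) (i + 1)) × Fin (layerDim d L (W p.1) (i + 1)),
      layerNTK p.2 x x' i h q.1 q.2 ^ 2) (initFilter d L W) (𝓝 0)

lemma sum_ite_eq_sq {N : ℕ} (c : ℝ) :
    ∑ q : Fin N × Fin N, ((if q.1 = q.2 then 1 else 0) * c) ^ 2 = N * c ^ 2 := by
  rw [Fintype.sum_prod_type]
  simp [ite_pow]

lemma diagConverges_zero : DiagConverges (L := L) W x x' 0 (Nat.zero_le L) := by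
  simpa [DiagConverges, layerNTK_zero, gram_zero, ntkLimit_zero] using tendsto_const_nhds

/-- A multiple of the identity has only N nonzero entries among N², so its mean square is of order
1/N. -/
lemma tendsto_sq_div_layerDim (hW : ∀ m, 1 ≤ m → ∀ i, 1 ≤ i → i ≤ L → m ≤ W m i) {i : ℕ}
    (h : i < L) {c : (Σ m, Params d L (W m)) → ℝ} {l : ℝ}
    (hc : Tendsto c (initFilter d L W) (𝓝 l)) :
    Tendsto (fun p => 1 / (layerDim d L (W p.1) (i + 1) : ℝ) ^ 2 *
      ∑ q : Fin (layerDim d L (W p.1) (i + 1)) × Fin (layerDim d L (W p.1) (i + 1)),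
        ((if q.1 = q.2 then 1 else 0) * c p) ^ 2) (initFilter d L W) (𝓝 0) := by
  refine ((hc.pow 2).div_atTop (tendsto_layerDim hW h)).congr' ?_
  filter_upwards [eventually_layerDim_pos hW i] with p hN
  have hN' : (0 : ℝ) < layerDim d L (W p.1) (i + 1) := by exact_mod_cast hN
  rw [sum_ite_eq_sq]
  field_simp

lemma meanSqVanishes_zero (hW : ∀ m, 1 ≤ m → ∀ i, 1 ≤ i → i ≤ L → m ≤ W m i) (h : 0 < L) :
    MeanSqVanishes W x x' 0 h.le := by
  have := tendsto_sq_div_layerDim hW h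
    (tendsto_const_nhds (x := gramLimit x x' 0) (f := initFilter d L W))
  refine this.congr fun p => ?_
  simp only [layerNTK_zero, gram_zero, ite_mul, one_mul, zero_mul]

section Step

/-- `DiagConverges` permits replacing the kernel entries by their limit; what remains is the average
of step·step, with limit `kappa0`. -/
lemma tendsto_trace_transfer (hW : ∀ m, 1 ≤ m → ∀ i, 1 ≤ i → i ≤ L → m ≤ W m i) {i : ℕ}
    (h : i < L) (hD : DiagConverges W x x' i h.le) :
    Tendsto (fun p => ∑ a, transfer p.2 x x' i h.le a a) (initFilter d L W)
      (𝓝 (ntkLimit x x' i * kappa0 (kappa1^[i] (uTilde x x')))) := by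
  have h1 := (tendsto_average_step (x := x) (x' := x') h hW
    (tendsto_gram hW i h.le)).const_mul (ntkLimit x x' i)
  have h2 : Tendsto (fun p => (∑ a, transfer p.2 x x' i h.le a a - ntkLimit x x' i *
      (2 / layerDim d L (W p.1) (i + 1) *
        ∑ a, step (preact p.2 x i h.le a) * step (preact p.2 x' i h.le a))) ^ 2)
      (initFilter d L W) (𝓝 0) := by
    have hD4 := Tendsto.const_mul 4 hD
    rw [mul_zero] at hD4
    refine squeeze_zero' (Eventually.of_forall fun p => sq_nonneg _) ?_ hD4
    filter_upwards [eventually_layerDim_pos hW i] with p hN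
    exact sq_trace_transfer_sub_le x x' i p.2 h.le hN _
  simpa using (tendsto_zero_of_sq h2).add h1

/-- The map `r` selects pairs of neurons: the diagonal with weight 1/n serves `DiagConverges`, all
pairs with weight 1/n² serve `MeanSqVanishes`. The variance bound is the same for each pair, so
averaging preserves it. -/
lemma tendsto_average_centredForm {i : ℕ} (h : i + 1 ≤ L)
    (hF : MeanSqVanishes W x x' i (Nat.le_of_lt h)) {α : ℕ → Type} [∀ n, Fintype (α n)]
    (r : ∀ n, α n → Fin n × Fin n) {c : ℕ → ℝ} (hc : ∀ n, 0 ≤ c n)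
    (hcα : ∀ n, 0 < n → c n * Fintype.card (α n) = 1)
    (hW : ∀ m, 1 ≤ m → ∀ i, 1 ≤ i → i ≤ L → m ≤ W m i) :
    Tendsto (fun p => c (layerDim d L (W p.1) (i + 1 + 1)) *
      ∑ q, centredForm p.2 x x' i h (r _ q).1 (r _ q).2 ^ 2) (initFilter d L W) (𝓝 0) := by
  have hg : Tendsto (fun p => 2 * ∑ a, ∑ b, transfer p.2 x x' i (Nat.le_of_lt h) a b ^ 2)
      (initFilter d L W) (𝓝 0) := by
    have h8 := (Tendsto.const_mul 4 hF).const_mul 2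
    rw [mul_zero, mul_zero] at h8
    exact squeeze_zero (fun p => by positivity)
      (fun p => mul_le_mul_of_nonneg_left (sum_transfer_sq_le x x' i p.2 _) zero_le_two) h8
  refine tendsto_zero_of_lintegral_resample (μ := fun m => initLaw d L (W m))
    (R := fun m => resampleLayer (i + 1)) (fun m => measurePreserving_resampleLayer (i + 1))
    (fun p => mul_nonneg (hc _) (Finset.sum_nonneg fun q _ => sq_nonneg _)) (fun m => ?_) hg ?_
  · have h1 : ∀ q, Measurable fun θ : Params d L (W m) =>
        centredForm θ x x' i h (r _ q).1 (r _ q).2 ^ 2 :=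
      fun q => (measurable_centredForm x x' i h _ _).pow_const 2
    change Measurable fun θ : Params d L (W m) => c (layerDim d L (W m) (i + 1 + 1)) *
      ∑ q, centredForm θ x x' i h (r _ q).1 (r _ q).2 ^ 2
    exact (Finset.measurable_fun_sum _ fun q _ => h1 q).const_mul _
  · filter_upwards [eventually_layerDim_pos hW (i + 1)] with p hN
    have hm := (measurePreserving_resampleLayer (d := d) (L := L) (w := W p.1) (i + 1)).measurable
    exact lintegral_ofReal_mul_sum_le (fun q θ' => sq_nonneg _)
      (fun q => ((measurable_centredForm x x' i h _ _).comp
        (hm.comp measurable_prodMk_left)).pow_const 2) (hc _) (hcα _ hN)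
      fun q => lintegral_sq_centredForm_le x x' i h _ _ p.2

lemma add_sq_le_two_mul (a b : ℝ) : (a + b) ^ 2 ≤ 2 * a ^ 2 + 2 * b ^ 2 := by
  nlinarith [sq_nonneg (a - b)]

lemma tendsto_diagonal_coefficient (hW : ∀ m, 1 ≤ m → ∀ i, 1 ≤ i → i ≤ L → m ≤ W m i) {i : ℕ}
    (h : i + 1 ≤ L) (hD : DiagConverges W x x' i (Nat.le_of_lt h)) :
    Tendsto (fun p => gram p.2 x x' (i + 1) h + 1 +
      ∑ a, transfer p.2 x x' i (Nat.le_of_lt h) a a) (initFilter d L W)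
      (𝓝 (ntkLimit x x' (i + 1))) := by
  rw [ntkLimit_succ, add_comm (_ * _)]
  exact ((tendsto_gram hW (i + 1) h x x').add_const 1).add (tendsto_trace_transfer hW h hD)

/-- The centred form vanishes in mean square over the neurons, and the remaining diagonal
coefficient is the same for every neuron. -/
lemma diagConverges_succ (hW : ∀ m, 1 ≤ m → ∀ i, 1 ≤ i → i ≤ L → m ≤ W m i) {i : ℕ}
    (h : i + 1 ≤ L) (hD : DiagConverges W x x' i (Nat.le_of_lt h))
    (hF : MeanSqVanishes W x x' i (Nat.le_of_lt h)) : DiagConverges W x x' (i + 1) h := by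
  have h1 := tendsto_average_centredForm h hF (α := fun n => Fin n) (fun n j => (j, j))
    (c := fun n => 1 / n) (fun n => by positivity) (fun n hn => by
      have : (n : ℝ) ≠ 0 := by positivity
      simp [this]) hW
  have h2 := ((tendsto_diagonal_coefficient hW h hD).sub_const (ntkLimit x x' (i + 1))).pow 2
  have h3 := (h1.const_mul 2).add (h2.const_mul 2)
  simp only [sub_self, ne_eq, OfNat.ofNat_ne_zero, not_false_eq_true, zero_pow, mul_zero,
    add_zero] at h3
  refine squeeze_zero' (Eventually.of_forall fun p => by positivity) ?_ h3
  filter_upwards [eventually_layerDim_pos hW (i + 1)] with p hN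
  have hN' : (0 : ℝ) < layerDim d L (W p.1) (i + 1 + 1) := by exact_mod_cast hN
  have hle : ∀ j, (layerNTK p.2 x x' (i + 1) h j j - ntkLimit x x' (i + 1)) ^ 2 ≤
      2 * centredForm p.2 x x' i h j j ^ 2 + 2 * (gram p.2 x x' (i + 1) h + 1 +
        ∑ a, transfer p.2 x x' i (Nat.le_of_lt h) a a - ntkLimit x x' (i + 1)) ^ 2 := by
    intro j
    rw [layerNTK_succ_eq_centredForm, if_pos rfl, one_mul, add_sub_assoc]
    exact add_sq_le_two_mul _ _
  refine (mul_le_mul_of_nonneg_left (Finset.sum_le_sum fun j _ => hle j)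
    (by positivity)).trans (le_of_eq ?_)
  rw [Finset.sum_add_distrib, ← Finset.mul_sum, Finset.sum_const, Finset.card_univ,
    Fintype.card_fin, nsmul_eq_mul]
  field_simp

/-- The strict inequality makes the outputs of layer `i + 1` a hidden layer of diverging width,
which the diagonal part needs in order to be negligible; at the output layer of width one it need
not be. -/
lemma meanSqVanishes_succ (hW : ∀ m, 1 ≤ m → ∀ i, 1 ≤ i → i ≤ L → m ≤ W m i) {i : ℕ}
    (h : i + 1 < L) (hD : DiagConverges W x x' i (Nat.le_of_lt h.le))
    (hF : MeanSqVanishes W x x' i (Nat.le_of_lt h.le)) : MeanSqVanishes W x x' (i + 1) h.le := by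
  have h1 := tendsto_average_centredForm h.le hF (α := fun n => Fin n × Fin n) (fun n q => q)
    (c := fun n => 1 / (n : ℝ) ^ 2) (fun n => by positivity) (fun n hn => by
      have : (n : ℝ) ≠ 0 := by positivity
      simp only [Fintype.card_prod, Fintype.card_fin, Nat.cast_mul]
      field_simp) hW
  have h2 := tendsto_sq_div_layerDim hW h (tendsto_diagonal_coefficient hW h.le hD)
  have h3 := (h1.const_mul 2).add (h2.const_mul 2)
  simp only [mul_zero, add_zero] at h3
  refine squeeze_zero (fun p => by positivity) (fun p => ?_) h3
  rw [mul_left_comm 2, mul_left_comm 2, ← mul_add]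
  refine mul_le_mul_of_nonneg_left ?_ (by positivity)
  rw [Finset.mul_sum Finset.univ _ (2 : ℝ), Finset.mul_sum Finset.univ _ (2 : ℝ),
    ← Finset.sum_add_distrib]
  refine Finset.sum_le_sum fun q _ => ?_
  rw [layerNTK_succ_eq_centredForm]
  exact add_sq_le_two_mul _ _

end Step

lemma diagConverges_and_meanSqVanishes
    (hW : ∀ m, 1 ≤ m → ∀ i, 1 ≤ i → i ≤ L → m ≤ W m i) (i : ℕ) (h : i ≤ L) :
    DiagConverges W x x' i h ∧ (i < L → MeanSqVanishes W x x' i h) := by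
  induction i with
  | zero => exact ⟨diagConverges_zero, meanSqVanishes_zero hW⟩
  | succ i ih =>
    obtain ⟨hD, hF⟩ := ih (by omega)
    exact ⟨diagConverges_succ hW h hD (hF (by omega)),
      fun h' => meanSqVanishes_succ hW h' hD (hF (by omega))⟩

lemma tendsto_layerNTK_last (hW : ∀ m, 1 ≤ m → ∀ i, 1 ≤ i → i ≤ L → m ≤ W m i) :
    Tendsto (fun p => layerNTK p.2 x x' L le_rfl ⟨0, by simp [layerDim]⟩ ⟨0, by simp [layerDim]⟩)
      (initFilter d L W) (𝓝 (ntkLimit x x' L)) := by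
  have hD := (diagConverges_and_meanSqVanishes (x := x) (x' := x') hW L le_rfl).1
  rw [← tendsto_sub_nhds_zero_iff]
  refine tendsto_zero_of_sq (squeeze_zero (fun p => sq_nonneg _) (fun p => ?_) hD)
  -- The output layer has a single neuron, so the average is one squared deviation.
  have e : 1 / (layerDim d L (W p.1) (L + 1) : ℝ) = 1 := by simp [layerDim]
  rw [e, one_mul]
  exact Finset.single_le_sum
    (f := fun j => (layerNTK p.2 x x' L le_rfl j j - ntkLimit x x' L) ^ 2)
    (fun j _ => sq_nonneg _) (Finset.mem_univ _)

lemma eventually_forall_preact_ne_zero (hW : ∀ m, 1 ≤ m → ∀ i, 1 ≤ i → i ≤ L → m ≤ W m i)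
    (x : EuclideanSpace ℝ (Fin d)) :
    ∀ᶠ p in initFilter d L W, ∀ (l : ℕ) (hl : l < L), ∀ a, preact p.2 x l hl.le a ≠ 0 := by
  have : ∀ᶠ p in initFilter d L W, ∀ l : Fin L, ∀ a, preact p.2 x l l.2.le a ≠ 0 :=
    eventually_all.2 fun l => eventually_preact_ne_zero hW l l.2.le x
  filter_upwards [this] with p hp l hl
  exact hp ⟨l, hl⟩

end TangentKernel

end NTK

theorem proposition1 (d L : ℕ) (C : ℝ) (w : ℕ → ℕ → ℕ)
    (hw : ∀ m : ℕ, 1 ≤ m → ∀ i : ℕ, 1 ≤ i → i ≤ L → m ≤ w m i ∧ (w m i : ℝ) ≤ C * m)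
    (x x' : EuclideanSpace ℝ (Fin d)) :
    (∀ z : EuclideanSpace ℝ (Fin d), Tendsto (fun m : ℕ => NTK.initLaw d L (w m)
        {θ₀ | ¬ DifferentiableAt ℝ (fun θ => NTK.centredNet θ₀ θ z) θ₀}) atTop (𝓝 0)) ∧
    ∀ ε : ℝ, 0 < ε → Tendsto (fun m : ℕ => NTK.initLaw d L (w m)
        {θ₀ | ε ≤ |NTK.finiteNTK θ₀ θ₀ x x' -
          ∑ l ∈ Finset.range (L + 1),
            (NTK.scale x x' * NTK.kappa1^[l] (NTK.uTilde x x') + if 1 ≤ l then 1 else 0) *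
              ∏ r ∈ Finset.Ico l L, NTK.kappa0 (NTK.kappa1^[r] (NTK.uTilde x x'))|})
        atTop (𝓝 0) := by
  have hW : ∀ m, 1 ≤ m → ∀ i, 1 ≤ i → i ≤ L → m ≤ w m i :=
    fun m hm i h1 h2 => (hw m hm i h1 h2).1
  refine ⟨fun z => ?_, fun ε hε => ?_⟩
  -- The filter is defined by outer measure, so it suffices that differentiability follows from the
  -- event that no hidden neuron sits at the kink.
  · refine (NTK.eventually_probFilter (P := fun p : Σ m, NTK.Params d L (w m) =>
      DifferentiableAt ℝ (fun θ => NTK.centredNet p.2 θ z) p.2)).1 ?_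
    filter_upwards [NTK.eventually_forall_preact_ne_zero hW z] with p hp
    exact NTK.differentiableAt_centredNet p.2 p.2 z hp
  -- The true kernel agrees with the recursively defined one only off the kinks; equality along the
  -- filter is enough for the limit.
  · refine NTK.tendsto_measure_le_abs_sub (X := fun p : Σ m, NTK.Params d L (w m) =>
      NTK.finiteNTK p.2 p.2 x x') ((NTK.tendsto_layerNTK_last hW).congr' ?_) hε
    filter_upwards [NTK.eventually_forall_preact_ne_zero hW x,
      NTK.eventually_forall_preact_ne_zero hW x'] with p hp hp'
    exact (NTK.finiteNTK_eq_layerNTK p.2 p.2 x x' hp hp').symm
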